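/- **Theorem 1 (Consistency).** Let $\mathbb X$ be a finite set, $w:\mathbb X\times\mathbb X\to\mathbb R^d$ a known function and write $\beta=(\beta_1,\beta_2,\beta_3)\in\mathbb R^{d}\times\mathbb R\times\mathbb R$. For each $n$ consider the directed network formation game with agents $1,\dots,n$, public attributes $X=(X_1,\dots,X_n)\in\mathbb X^n$, private types $A_0=(A_{10},\dots,A_{n0})\in\mathbb R^n$, private shocks $\varepsilon=(\varepsilon_{ij})$, a public signal $\nu$ and a network $G=(G_{ij})_{i\ne j}\in\{0,1\}^{n(n-1)}$. Agent $i$ chooses $G_i=(G_{ij})_{j\ne i}$ and has payoff $$U_i=\sum_{j\ne i}G_{ij}\Big(w(X_i,X_j)'\beta_{1}+A_{i0}+G_{ji}\beta_{2}+\tfrac1{n-2}\sum_{k\ne i,j}G_{jk}\beta_{3}+\varepsilon_{ij}\Big)$$ at the true parameter $\beta=\beta_0$. Assume: 1. $X_1,\dots,X_n$ are independent; given $X$, the $A_{i0}$ are independent, and the law of $A_{i0}$ is a function $F_{A|X}$, common to all agents, of $X$ and the own attribute $X_i$, concentrated on a compact set $\mathbb A\subset\mathbb R$ that does not depend on $n$;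 the $\varepsilon_{ij}$ are i.i.d. with the standard logistic distribution, and $\varepsilon$ is independent of $(X,A_0,\nu)$. 2. (Equilibrium selection) Given $X$, a belief profile assigns to each agent $i$ and each type $a$ a probability distribution $\sigma_i(\cdot\mid X,a)$ on the actions of $i$. It is an equilibrium if $\sigma_i(g\mid X,a)$ equals, for all $i,a,g$, the probability (over $\varepsilon_i$) that $g$ is the unique maximizer of the expected payoff of $i$ of type $a$, when the others' types are drawn independently from their conditional laws given $X$ and they play according to $\sigma$. It is symmetric if the probability that $i$ proposes a link to $j$ given $X$ and $A_{i0}=a$ depends only on $(X_i,X_j)$ and $a$. For all large $n$ there is a measurable selection $\sigma^*=\lambda_n(X,\nu)$ of symmetric equilibria such that almost surely every $G_i$ maximizes the expected payoff of $i$, given $X$, $A_{i0}$ and $\varepsilon_i$, against $\sigma^*$. 3. $\beta_0\in\operatorname{int}\mathbb B$, with $\mathbb B\subset\mathbb R^{d+2}$ compact. 4. (Joint identification) For a matrix $q=(q_{ij})$ put $$Q_{ij}(\beta,a,q)=\Lambda\Big(w(X_i,X_j)'\beta_1+a+q_{ji}\beta_2+\tfrac1{n-2}\sum_{k\ne i,j}q_{jk}\beta_3\Big),\qquad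 \Lambda(t)=\frac{e^t}{1+e^t},$$ $$\mathcal L_n(\beta,A,q)=\frac1{n(n-1)}\sum_i\sum_{j\ne i}\big[G_{ij}\ln Q_{ij}(\beta,A_i,q)+(1-G_{ij})\ln(1-Q_{ij}(\beta,A_i,q))\big].$$ Let $q_{ij}$ be the probability, given $X$ and the selected equilibrium $\sigma^*$, that $i$ proposes a link to $j$ (with $A_{i0}$ integrated out under its conditional law given $X$), and let $\bar{\mathcal L}_n(\beta,A)=\mathbb E[\mathcal L_n(\beta,A,q)\mid X,A_0,\nu]$. Then, for large $n$, $(\beta_0,A_0)$ is an identifiably unique (well-separated) maximizer of $\bar{\mathcal L}_n$ on $\mathbb B\times\mathbb A^n$: for all $r,\delta>0$ there is $\eta>0$ such that for all large $n$, with probability at least $1-\delta$, $$\bar{\mathcal L}_n(\beta,A)\le\bar{\mathcal L}_n(\beta_0,A_0)-\eta\quad\text{for all }(\beta,A)\in\mathbb B\times\mathbb A^n\text{ with }\|\beta-\beta_0\|+\tfrac1n\sum_i|A_i-A_{i0}|\ge r.$$ Let $\hat q_{ij}=\hat q_{n,st}$ for $X_i=x_s$, $X_j=x_t$, where $\hat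 q_{n,st}$ is the fraction of the ordered pairs $(k,l)$, $k\ne l$, with $X_k=x_s$ and $X_l=x_t$ for which $G_{kl}=1$, and let $(\hat\beta,\hat A)$ be any maximizer of $\mathcal L_n(\beta,A,\hat q)$ over $\mathbb B\times\mathbb A^n$. Then, as $n\to\infty$, $$\hat\beta\xrightarrow{p}\beta_0\qquad\text{and}\qquad \max_{1\le i\le n}|\hat A_i-A_{i0}|\xrightarrow{p}0 .$$ -/

import Mathlib

open MeasureTheory ProbabilityTheory Filter Topology

namespace NetFormation

noncomputable section

/-- The logistic cumulative distribution function `t ↦ 1 / (1 + exp (-t))`. -/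
def logisticCDF : StieltjesFunction ℝ where
  toFun := Real.sigmoid
  mono' := Real.sigmoid_monotone
  right_continuous' := fun _ => continuous_sigmoid.continuousWithinAt

/-- The (standard) logistic distribution on the real line. -/
def logistic : Measure ℝ := logisticCDF.measure

instance : IsProbabilityMeasure logistic :=
  logisticCDF.isProbabilityMeasure Real.tendsto_sigmoid_atBot Real.tendsto_sigmoid_atTop

/-- Actions of agent `i`: a link proposal or none to each other agent, never to oneself. -/
abbrev Action {n : ℕ} (i : Fin n) : Type := {g : Fin n → Bool // g i = false}

/-- A directed network: one action for each agent. -/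
abbrev Network (n : ℕ) : Type := (i : Fin n) → Action i

instance {n : ℕ} (i : Fin n) : Nonempty (Action i) := ⟨⟨fun _ => false, rfl⟩⟩

/-- The link indicator `G i j` as a real number. -/
def link {n : ℕ} (g : Network n) (i j : Fin n) : ℝ := if (g i).1 j = true then 1 else 0

/-- Parameters `β = (β₁, β₂, β₃)`: `β₁ ∈ ℝ^d` for the homophily term, `β₂` for reciprocity,
`β₃` for the popularity term. -/
abbrev Param (d : ℕ) : Type := (Fin d → ℝ) × ℝ × ℝ

section Game

variable {𝕏 : Type*} {d n : ℕ}

/-- `w(xᵢ, xⱼ)'β₁ + a + m j i β₂ + (n - 2)⁻¹ ∑_{k ≠ i, j} m j k β₃`, for a matrix `m` of links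
or of link probabilities. -/
def index (w : 𝕏 → 𝕏 → Fin d → ℝ) (β : Param d) (x : Fin n → 𝕏) (m : Fin n → Fin n → ℝ)
    (a : ℝ) (i j : Fin n) : ℝ :=
  w (x i) (x j) ⬝ᵥ β.1 + a + m j i * β.2.1
    + ((n : ℝ) - 2)⁻¹ * (∑ k ∈ Finset.univ.filter (fun k => k ≠ i ∧ k ≠ j), m j k) * β.2.2

/-- The payoff of agent `i` of private type `a` with shocks `e` in the network `g`. -/
def payoff (w : 𝕏 → 𝕏 → Fin d → ℝ) (β : Param d) (x : Fin n → 𝕏) (i : Fin n) (a : ℝ)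
    (e : Fin n → ℝ) (g : Network n) : ℝ :=
  ∑ j, link g i j * (index w β x (link g) a i j + e j)

/-- A belief profile, given the public attributes: `σ i a g` is the probability that agent `i`
of private type `a` plays the action `g`. -/
abbrev Belief (n : ℕ) : Type := (i : Fin n) → ℝ → Action i → ℝ

/-- Expected payoff of agent `i` from the action `gi`, where the other agents' private types are
independent with laws `μA j` and they play according to `σ`. -/
def expectedPayoff (w : 𝕏 → 𝕏 → Fin d → ℝ) (β : Param d) (x : Fin n → 𝕏)
    (μA : Fin n → Measure ℝ) (σ : Belief n) (i : Fin n) (a : ℝ) (e : Fin n → ℝ)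
    (gi : Action i) : ℝ :=
  ∑ g : Network n, if g i = gi then
    (∏ j ∈ Finset.univ.erase i, ∫ t, σ j t (g j) ∂(μA j)) * payoff w β x i a e g else 0

/-- Bayesian equilibrium: every `σ i a` is a probability distribution on actions, and it agrees
with the probability, over i.i.d. logistic shocks, that the action is the best reply. -/
def IsEquilibrium (w : 𝕏 → 𝕏 → Fin d → ℝ) (β : Param d) (x : Fin n → 𝕏)
    (μA : Fin n → Measure ℝ) (σ : Belief n) : Prop :=
  (∀ (i : Fin n) (a : ℝ), (∀ g, 0 ≤ σ i a g) ∧ ∑ g, σ i a g = 1) ∧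
  ∀ (i : Fin n) (a : ℝ) (g : Action i),
    σ i a g = (Measure.pi (fun _ : Fin n => logistic)).real
      {e | ∀ g', g' ≠ g →
        expectedPayoff w β x μA σ i a e g' < expectedPayoff w β x μA σ i a e g}

/-- Probability that agent `i` of private type `a` proposes a link to `j`. -/
def linkProb (σ : Belief n) (i j : Fin n) (a : ℝ) : ℝ :=
  ∑ g : Action i, if g.1 j = true then σ i a g else 0

/-- Ordered pairs of agents with the same observed attributes, and the same private type of the
proposer, have the same link probability. -/
def IsSymmetric (x : Fin n → 𝕏) (σ : Belief n) : Prop :=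
  ∀ i j k l : Fin n, i ≠ j → k ≠ l → x i = x k → x j = x l →
    ∀ a : ℝ, linkProb σ i j a = linkProb σ k l a

/-- `q i j`: the probability that `i` proposes a link to `j`, given the public attributes and
the belief profile, the private type being integrated out. -/
def meanLinkProb (μA : Fin n → Measure ℝ) (σ : Belief n) (i j : Fin n) : ℝ :=
  ∫ a, linkProb σ i j a ∂(μA i)

/-- The logit conditional choice probability `Q i j (β, a, q)`. -/
def choiceProb (w : 𝕏 → 𝕏 → Fin d → ℝ) (β : Param d) (x : Fin n → 𝕏)
    (q : Fin n → Fin n → ℝ) (a : ℝ) (i j : Fin n) : ℝ :=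
  Real.sigmoid (index w β x q a i j)

/-- The normalized log-likelihood `L_n(β, A, q)` of the network `g`. -/
def logLik (w : 𝕏 → 𝕏 → Fin d → ℝ) (x : Fin n → 𝕏) (g : Network n) (β : Param d)
    (A : Fin n → ℝ) (q : Fin n → Fin n → ℝ) : ℝ :=
  ((n : ℝ) * ((n : ℝ) - 1))⁻¹ * ∑ i, ∑ j ∈ Finset.univ.erase i,
    (link g i j * Real.log (choiceProb w β x q (A i) i j)
      + (1 - link g i j) * Real.log (1 - choiceProb w β x q (A i) i j))

/-- First step: the empirical frequency of proposals from attribute `s` to attribute `t`. -/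
def frequency [DecidableEq 𝕏] (x : Fin n → 𝕏) (g : Network n) (s t : 𝕏) : ℝ :=
  (∑ i, ∑ j ∈ Finset.univ.erase i, if x i = s ∧ x j = t then link g i j else 0)
    / (∑ i, ∑ j ∈ Finset.univ.erase i, if x i = s ∧ x j = t then 1 else 0)

/-- The first-step estimate `q̂ i j`, read off at the attributes of `i` and `j`. -/
def qHat [DecidableEq 𝕏] (x : Fin n → 𝕏) (g : Network n) (i j : Fin n) : ℝ :=
  frequency x g (x i) (x j)

/-- `(β, A)` maximizes the log-likelihood with `q̂` plugged in, over `β ∈ B` and `A ∈ 𝔸ⁿ`. -/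
def IsTwoStepMLE [DecidableEq 𝕏] (w : 𝕏 → 𝕏 → Fin d → ℝ) (B : Set (Param d)) (𝔸 : Set ℝ)
    (x : Fin n → 𝕏) (g : Network n) (β : Param d) (A : Fin n → ℝ) : Prop :=
  β ∈ B ∧ (∀ i, A i ∈ 𝔸) ∧
    ∀ β' ∈ B, ∀ A' : Fin n → ℝ, (∀ i, A' i ∈ 𝔸) →
      logLik w x g β' A' (qHat x g) ≤ logLik w x g β A (qHat x g)

end Game

/-- The random objects of the `n`-agent game: observed attributes, private types, public signal,
payoff shocks and the network. -/
structure Sample (𝕏 V Ω : Type*) (n : ℕ) where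
  X : Ω → Fin n → 𝕏
  A : Ω → Fin n → ℝ
  signal : Ω → V
  shock : Ω → Fin n → Fin n → ℝ
  G : Ω → Network n

section Assumptions

variable {𝕏 V Ω : Type*} [MeasurableSpace 𝕏] [MeasurableSpace V] [MeasurableSpace Ω] {d n : ℕ}

/-- The random objects are measurable, and
(a) the attributes are independent across agents;
(b) given `X = x` the private types are independent, that of agent `i` with law `F x (x i)`;
(c) the shocks are i.i.d. logistic;
(d) the shocks are independent of attributes, private types and public signal. -/
structure Primitives (P : Measure Ω) (S : Sample 𝕏 V Ω n) (F : (Fin n → 𝕏) → 𝕏 → Measure ℝ) :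
    Prop where
  measurable_X : Measurable S.X
  measurable_A : Measurable S.A
  measurable_signal : Measurable S.signal
  measurable_shock : Measurable S.shock
  measurable_G : Measurable S.G
  indep_X : iIndepFun (fun (i : Fin n) ω => S.X ω i) P
  law_A : ∀ (x : Fin n → 𝕏) (s : Set (Fin n → ℝ)), MeasurableSet s →
    P {ω | S.X ω = x ∧ S.A ω ∈ s} = P {ω | S.X ω = x} * Measure.pi (fun i => F x (x i)) s
  law_shock : P.map S.shock = Measure.pi (fun _ => Measure.pi (fun _ => logistic))
  indep_shock : IndepFun S.shock (fun ω => (S.X ω, S.A ω, S.signal ω)) P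

/-- An equilibrium selection mechanism `lam` maps attributes and public signal measurably to a
symmetric equilibrium, and in the observed network every agent best-replies, given the private
type and the shocks, to the selected equilibrium. -/
structure EquilibriumSelection (P : Measure Ω) (S : Sample 𝕏 V Ω n)
    (F : (Fin n → 𝕏) → 𝕏 → Measure ℝ) (w : 𝕏 → 𝕏 → Fin d → ℝ) (β₀ : Param d)
    (lam : (Fin n → 𝕏) → V → Belief n) : Prop where
  measurable_lam : ∀ (x : Fin n → 𝕏) (i : Fin n) (g : Action i),
    Measurable (fun p : V × ℝ => lam x p.1 i p.2 g)
  equilibrium : ∀ᵐ ω ∂P,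
    IsEquilibrium w β₀ (S.X ω) (fun i => F (S.X ω) (S.X ω i)) (lam (S.X ω) (S.signal ω))
  symmetric : ∀ᵐ ω ∂P, IsSymmetric (S.X ω) (lam (S.X ω) (S.signal ω))
  best_reply : ∀ᵐ ω ∂P, ∀ (i : Fin n) (g : Action i),
    expectedPayoff w β₀ (S.X ω) (fun i => F (S.X ω) (S.X ω i)) (lam (S.X ω) (S.signal ω))
        i (S.A ω i) (S.shock ω i) g
      ≤ expectedPayoff w β₀ (S.X ω) (fun i => F (S.X ω) (S.X ω i)) (lam (S.X ω) (S.signal ω))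
        i (S.A ω i) (S.shock ω i) (S.G ω i)

/-- The expected log-likelihood `E[L_n(β, A, q) | X, A₀, σ*]` at `ω`, with `q` the link
probabilities of the selected equilibrium `σ* = lam X signal`; the conditional expectation is
taken with the regular conditional distribution of the network, so that it is defined for all
`(β, A)` at once. -/
def expectedLogLik (P : Measure Ω) [IsFiniteMeasure P] (S : Sample 𝕏 V Ω n)
    (F : (Fin n → 𝕏) → 𝕏 → Measure ℝ) (w : 𝕏 → 𝕏 → Fin d → ℝ)
    (lam : (Fin n → 𝕏) → V → Belief n) (ω : Ω) (β : Param d) (A : Fin n → ℝ) : ℝ :=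
  ∫ g, logLik w (S.X ω) g β A
      (meanLinkProb (fun i => F (S.X ω) (S.X ω i)) (lam (S.X ω) (S.signal ω)))
    ∂(condDistrib S.G (fun ω => (S.X ω, S.A ω, S.signal ω)) P (S.X ω, S.A ω, S.signal ω))

/-- `(β₀, A₀)` maximizes the expected log-likelihood at `ω` over `B × 𝔸ⁿ`, with a margin of at
least `η` over all points at distance at least `r`. Distance is measured as the log-likelihood
averages over agents: `‖β - β₀‖ + n⁻¹ ∑ i, |A i - A₀ i|`. -/
def SeparatedMaximum (P : Measure Ω) [IsFiniteMeasure P] (S : Sample 𝕏 V Ω n)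
    (F : (Fin n → 𝕏) → 𝕏 → Measure ℝ) (w : 𝕏 → 𝕏 → Fin d → ℝ)
    (lam : (Fin n → 𝕏) → V → Belief n) (B : Set (Param d)) (𝔸 : Set ℝ) (β₀ : Param d)
    (r η : ℝ) (ω : Ω) : Prop :=
  ∀ β ∈ B, ∀ A : Fin n → ℝ, (∀ i, A i ∈ 𝔸) →
    r ≤ ‖β - β₀‖ + (n : ℝ)⁻¹ * ∑ i, |A i - S.A ω i| →
      expectedLogLik P S F w lam ω β A + η ≤ expectedLogLik P S F w lam ω β₀ (S.A ω)

end Assumptions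

end

end NetFormation

namespace NetFormation

noncomputable section

/-! ### The softplus function -/

/-! An agent's payoff is affine in the links proposed by the others, whose types and play are
independent under the agent's beliefs. Its expectation is therefore a sum over the proposed links of
index plus shock, the index being taken at the mean link probabilities `q` of the selected
equilibrium (`IsEquilibrium.expectedPayoff_eq`). Ties have probability zero, so given attributes,
types and signal the links are independent logits (`EquilibriumSelection.ae_link_eq`), and the
expected log-likelihood is a logit likelihood at the true link probabilities
(`EquilibriumSelection.ae_expectedLogLik_eq`).

Hoeffding's inequality and a union bound over linearly many events of exponentially small
probability give laws of large numbers in all rows and columns at once, and for the types; this is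
the event `IsTypical`. The signal may be correlated with the types, so the law for the types has to
be uniform in the shift through which the equilibrium enters the logistic function. A Lipschitz
bound and a finite net provide this.

The rest is deterministic. The equilibrium condition says that `q` is the type average of the logit
probabilities, so column averages of links are close to `q`, and so is `q̂`, on average in every
column (`IsTypical.sum_abs_qHat_sub_le`). Attributes carried by few agents have little weight there,
hence no lower bound on their frequencies is needed. Indices then move little on average in every
row, the feasible likelihood is uniformly close to the expected one (`IsTypical.abs_logLik_sub_le`),
and the separated maximum forces the common parameter to converge.

Identification controls the types only on average. For the maximum, note that each estimated type
maximizes the logit likelihood of its own row, which is uniformly strongly concave on the compact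
range. Its error is thus bounded by the score of the row at the true type, which is small for all
rows simultaneously (`IsTypical.abs_type_sub_le`). -/

/-- The softplus function `z ↦ log (1 + exp z)`, a primitive of the logistic function. -/
def softplus (z : ℝ) : ℝ := Real.log (1 + Real.exp z)

lemma one_sub_sigmoid (z : ℝ) : 1 - Real.sigmoid z = (1 + Real.exp z)⁻¹ := by
  rw [← Real.sigmoid_neg, Real.sigmoid_def, neg_neg]

lemma log_one_sub_sigmoid (z : ℝ) : Real.log (1 - Real.sigmoid z) = -softplus z := by
  rw [one_sub_sigmoid, Real.log_inv, softplus]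

lemma sigmoid_eq_exp_div (z : ℝ) : Real.sigmoid z = Real.exp z / (1 + Real.exp z) := by
  have h := one_sub_sigmoid z
  have : (0 : ℝ) < 1 + Real.exp z := by positivity
  have h2 : Real.sigmoid z = 1 - (1 + Real.exp z)⁻¹ := by linarith
  rw [h2]; field_simp; ring

lemma log_sigmoid (z : ℝ) : Real.log (Real.sigmoid z) = z - softplus z := by
  rw [sigmoid_eq_exp_div, Real.log_div (Real.exp_pos z).ne' (by positivity), Real.log_exp, softplus]

lemma hasDerivAt_softplus (z : ℝ) : HasDerivAt softplus (Real.sigmoid z) z := by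
  have h : HasDerivAt (fun z => 1 + Real.exp z) (Real.exp z) z :=
    (Real.hasDerivAt_exp z).const_add 1
  have := h.log (by positivity)
  rwa [← sigmoid_eq_exp_div] at this

lemma abs_softplus_sub_le (s t : ℝ) : |softplus s - softplus t| ≤ |s - t| := by
  have := Convex.norm_image_sub_le_of_norm_hasDerivWithin_le (f := softplus) (f' := Real.sigmoid)
    (s := Set.univ) (x := t) (y := s) (C := 1)
    (fun z _ => (hasDerivAt_softplus z).hasDerivWithinAt)
    (fun z _ => by rw [Real.norm_of_nonneg (Real.sigmoid_nonneg z)]; exact Real.sigmoid_le_one z)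
    convex_univ (Set.mem_univ _) (Set.mem_univ _)
  simpa using this

lemma abs_sigmoid_sub_le (s t : ℝ) : |Real.sigmoid s - Real.sigmoid t| ≤ |s - t| := by
  have := Convex.norm_image_sub_le_of_norm_hasDerivWithin_le (f := Real.sigmoid)
    (f' := fun z => Real.sigmoid z * (1 - Real.sigmoid z))
    (s := Set.univ) (x := t) (y := s) (C := 1)
    (fun z _ => (Real.hasDerivAt_sigmoid z).hasDerivWithinAt)
    (fun z _ => by
      have h0 := Real.sigmoid_nonneg z
      have h1 := Real.sigmoid_le_one z
      rw [Real.norm_of_nonneg (mul_nonneg h0 (by linarith))]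
      nlinarith)
    convex_univ (Set.mem_univ _) (Set.mem_univ _)
  simpa using this

/-- A lower bound for the derivative of the logistic function on `[-M, M]`. -/
def curvature (M : ℝ) : ℝ := Real.sigmoid (-M) ^ 2

lemma curvature_pos (M : ℝ) : 0 < curvature M := pow_pos (Real.sigmoid_pos _) 2

/-- The derivative is `σ (1 - σ)`, and by monotonicity and the symmetry `1 - σ z = σ (-z)` both
factors are at least `σ (-M)` on `[-M, M]`. -/
lemma curvature_mul_sub_le {M s t : ℝ} (hs : -M ≤ s) (hst : s ≤ t) (ht : t ≤ M) :
    curvature M * (t - s) ≤ Real.sigmoid t - Real.sigmoid s := by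
  have hmono : MonotoneOn (fun z => Real.sigmoid z - curvature M * z) (Set.Icc (-M) M) := by
    refine monotoneOn_of_hasDerivWithinAt_nonneg (convex_Icc _ _)
      (f' := fun z => Real.sigmoid z * (1 - Real.sigmoid z) - curvature M * 1) ?_ ?_ ?_
    · exact (continuous_sigmoid.sub (continuous_const.mul continuous_id)).continuousOn
    · intro z _
      exact ((Real.hasDerivAt_sigmoid z).sub ((hasDerivAt_id z).const_mul _)).hasDerivWithinAt
    · intro z hz
      have hz' := interior_subset hz
      have h1 : Real.sigmoid (-M) ≤ Real.sigmoid z := Real.sigmoid_le hz'.1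
      have h2 : Real.sigmoid (-M) ≤ 1 - Real.sigmoid z := by
        rw [← Real.sigmoid_neg]; exact Real.sigmoid_le (neg_le_neg hz'.2)
      have h3 := Real.sigmoid_pos (-M)
      simp only [curvature]
      nlinarith
  have := hmono ⟨hs, hst.trans ht⟩ ⟨hs.trans hst, ht⟩ hst
  simp only at this
  linarith

/-- Strong convexity of `softplus` on `[-M, M]`. -/
lemma softplus_add_le {M s t : ℝ} (hs : |s| ≤ M) (ht : |t| ≤ M) :
    softplus s + Real.sigmoid s * (t - s) + curvature M / 2 * (t - s) ^ 2 ≤ softplus t := by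
  obtain ⟨hs1, hs2⟩ := abs_le.1 hs
  obtain ⟨ht1, ht2⟩ := abs_le.1 ht
  set f : ℝ → ℝ := fun z =>
    softplus z - Real.sigmoid s * (z - s) - curvature M / 2 * (z - s) ^ 2 with hf
  -- By `curvature_mul_sub_le` this derivative has the sign of `z - s`, so `f` is minimal at `s`.
  have hd : ∀ z, HasDerivAt f (Real.sigmoid z - Real.sigmoid s - curvature M * (z - s)) z := by
    intro z
    have h1 : HasDerivAt (fun z : ℝ => z - s) 1 z := (hasDerivAt_id z).sub_const s
    have := ((hasDerivAt_softplus z).sub (h1.const_mul (Real.sigmoid s))).sub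
      ((h1.pow 2).const_mul (curvature M / 2))
    refine this.congr_deriv ?_
    simp; ring
  have hc : Continuous f := continuous_iff_continuousAt.2 fun z => (hd z).continuousAt
  have key : f s ≤ f t := by
    rcases le_total s t with h | h
    · refine monotoneOn_of_hasDerivWithinAt_nonneg (convex_Icc s t) hc.continuousOn
        (fun z _ => (hd z).hasDerivWithinAt) ?_ ⟨le_rfl, h⟩ ⟨h, le_rfl⟩ h
      intro z hz
      have hz' := interior_subset hz
      have := curvature_mul_sub_le hs1 hz'.1 (hz'.2.trans ht2)
      linarith
    · refine antitoneOn_of_hasDerivWithinAt_nonpos (convex_Icc t s) hc.continuousOn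
        (fun z _ => (hd z).hasDerivWithinAt) ?_ ⟨le_rfl, h⟩ ⟨h, le_rfl⟩ h
      intro z hz
      have hz' := interior_subset hz
      have := curvature_mul_sub_le (ht1.trans hz'.1) hz'.2 hs2
      linarith
  simp only [hf, sub_self] at key
  nlinarith

/-- A point where a logit log-likelihood is at least as large as at `a₀` is close to `a₀` if the
score at `a₀` is small. -/
lemma abs_sub_mul_card_le_of_logit_le {ι : Type*} (s : Finset ι) {M a a₀ : ℝ} (g y : ι → ℝ)
    (hya : ∀ j ∈ s, |y j + a| ≤ M) (hya₀ : ∀ j ∈ s, |y j + a₀| ≤ M)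
    (h : ∑ j ∈ s, (g j * (y j + a₀) - softplus (y j + a₀))
      ≤ ∑ j ∈ s, (g j * (y j + a) - softplus (y j + a))) :
    curvature M / 2 * (s.card * |a - a₀|) ≤ |∑ j ∈ s, (g j - Real.sigmoid (y j + a₀))| := by
  have h1 : ∑ j ∈ s, (g j * (y j + a) - softplus (y j + a)) ≤
      ∑ j ∈ s, (g j * (y j + a₀) - softplus (y j + a₀)
        + (g j - Real.sigmoid (y j + a₀)) * (a - a₀) - curvature M / 2 * (a - a₀) ^ 2) := by
    refine Finset.sum_le_sum fun j hj => ?_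
    have := softplus_add_le (hya₀ j hj) (hya j hj)
    rw [show y j + a - (y j + a₀) = a - a₀ by ring] at this
    nlinarith
  have h1 := h.trans h1
  rw [Finset.sum_sub_distrib (g := fun _ => curvature M / 2 * (a - a₀) ^ 2),
    Finset.sum_add_distrib, ← Finset.sum_mul, Finset.sum_const, nsmul_eq_mul] at h1
  have h2 : s.card * (curvature M / 2 * (a - a₀) ^ 2)
      ≤ (∑ j ∈ s, (g j - Real.sigmoid (y j + a₀))) * (a - a₀) := by linarith
  -- The quadratic gain is at most score times displacement; one factor `|a - a₀|` cancels.
  rcases eq_or_ne a a₀ with rfl | hne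
  · simp
  have hpos : 0 < |a - a₀| := abs_pos.2 (sub_ne_zero.2 hne)
  have h3 := h2.trans (le_abs_self _)
  rw [abs_mul, ← sq_abs (a - a₀)] at h3
  refine le_of_mul_le_mul_right ?_ hpos
  calc _ = s.card * (curvature M / 2 * |a - a₀| ^ 2) := by ring
    _ ≤ _ := h3

/-! ### Deterministic bounds for the index and the log-likelihood -/

section Deterministic

variable {𝕏 : Type*} {d n : ℕ}

lemma link_nonneg (g : Network n) (i j : Fin n) : 0 ≤ link g i j := by
  unfold link; split_ifs <;> norm_num

lemma link_le_one (g : Network n) (i j : Fin n) : link g i j ≤ 1 := by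
  unfold link; split_ifs <;> norm_num

lemma index_eq_add (w : 𝕏 → 𝕏 → Fin d → ℝ) (β : Param d) (x : Fin n → 𝕏)
    (q : Fin n → Fin n → ℝ) (a : ℝ) (i j : Fin n) :
    index w β x q a i j = index w β x q 0 i j + a := by
  unfold index; ring

/-- The logit log-likelihood with link probabilities (or links) `p` and indices `z`. -/
def logitLik (p z : Fin n → Fin n → ℝ) : ℝ :=
  ((n : ℝ) * ((n : ℝ) - 1))⁻¹ * ∑ i, ∑ j ∈ Finset.univ.erase i, (p i j * z i j - softplus (z i j))

/-- Since `log σ(z) = z - softplus z` and `log (1 - σ(z)) = -softplus z`, every term is affine in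
the link. Conditional expectation therefore only replaces links by their probabilities. -/
lemma logLik_eq_logitLik (w : 𝕏 → 𝕏 → Fin d → ℝ) (x : Fin n → 𝕏) (g : Network n) (β : Param d)
    (A : Fin n → ℝ) (q : Fin n → Fin n → ℝ) :
    logLik w x g β A q = logitLik (link g) (fun i j => index w β x q (A i) i j) := by
  unfold logLik logitLik choiceProb
  congr 1
  refine Finset.sum_congr rfl fun i _ => Finset.sum_congr rfl fun j _ => ?_
  rw [log_sigmoid, log_one_sub_sigmoid]; ring

lemma abs_reciprocity_le (β : Param d) : |β.2.1| ≤ ‖β‖ :=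
  (norm_fst_le β.2).trans (norm_snd_le β)

lemma abs_popularity_le (β : Param d) : |β.2.2| ≤ ‖β‖ :=
  (norm_snd_le β.2).trans (norm_snd_le β)

/-- Finiteness of the attribute set gives one constant for all pairs of agents and all `n`. -/
lemma exists_dotProduct_bound [Finite 𝕏] (w : 𝕏 → 𝕏 → Fin d → ℝ) :
    ∃ W, 0 ≤ W ∧ ∀ s t b, |w s t ⬝ᵥ b| ≤ W * ‖b‖ := by
  have := Fintype.ofFinite 𝕏
  refine ⟨∑ s, ∑ t, ∑ l, |w s t l|, by positivity, fun s t b => ?_⟩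
  calc |w s t ⬝ᵥ b| ≤ ∑ l, |w s t l| * ‖b‖ := by
        refine (Finset.abs_sum_le_sum_abs _ _).trans (Finset.sum_le_sum fun l _ => ?_)
        rw [abs_mul]
        exact mul_le_mul_of_nonneg_left (norm_le_pi_norm b l) (abs_nonneg _)
    _ = (∑ l, |w s t l|) * ‖b‖ := by rw [Finset.sum_mul]
    _ ≤ _ := by
        refine mul_le_mul_of_nonneg_right ?_ (norm_nonneg _)
        calc ∑ l, |w s t l| ≤ ∑ t, ∑ l, |w s t l| :=
              Finset.single_le_sum (f := fun t => ∑ l, |w s t l|)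
                (fun _ _ => by positivity) (Finset.mem_univ t)
          _ ≤ _ := Finset.single_le_sum (f := fun s => ∑ t, ∑ l, |w s t l|)
                (fun _ _ => by positivity) (Finset.mem_univ s)

lemma card_filter_ne_ne {i j : Fin n} (hij : i ≠ j) :
    ((Finset.univ.filter (fun k : Fin n => k ≠ i ∧ k ≠ j)).card : ℝ) = (n : ℝ) - 2 := by
  have h : Finset.univ.filter (fun k : Fin n => k ≠ i ∧ k ≠ j) = (Finset.univ.erase i).erase j := by
    ext k; simp [and_comm]
  have hj : j ∈ Finset.univ.erase i := by simp [hij.symm]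
  have hi : i ∈ (Finset.univ : Finset (Fin n)) := Finset.mem_univ i
  have h1 := Finset.card_erase_add_one hj
  have h2 := Finset.card_erase_add_one hi
  rw [Finset.card_univ, Fintype.card_fin] at h2
  rw [h]
  have h3 : ((Finset.univ.erase i).erase j).card + 2 = n := by omega
  have h4 : (((Finset.univ.erase i).erase j).card : ℝ) + 2 = n := by exact_mod_cast h3
  linarith

lemma popularity_mem_Icc {q : Fin n → Fin n → ℝ} (hq : ∀ i j, q i j ∈ Set.Icc (0 : ℝ) 1)
    (hn : 3 ≤ n) {i j : Fin n} (hij : i ≠ j) :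
    ((n : ℝ) - 2)⁻¹ * (∑ k ∈ Finset.univ.filter (fun k => k ≠ i ∧ k ≠ j), q j k)
      ∈ Set.Icc (0 : ℝ) 1 := by
  have hn' : (0 : ℝ) < (n : ℝ) - 2 := by
    have : (3 : ℝ) ≤ n := by exact_mod_cast hn
    linarith
  constructor
  · exact mul_nonneg (inv_nonneg.2 hn'.le) (Finset.sum_nonneg fun k _ => (hq j k).1)
  · rw [inv_mul_le_iff₀ hn', mul_one, ← card_filter_ne_ne hij]
    calc _ ≤ ∑ k ∈ Finset.univ.filter (fun k => k ≠ i ∧ k ≠ j), (1 : ℝ) :=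
          Finset.sum_le_sum fun k _ => (hq j k).2
      _ = _ := by simp

/-- The index is linear in `β`; the reciprocity and popularity coefficients lie in `[0, 1]`, which
accounts for the `2` next to `W`. -/
lemma abs_index_sub_le {w : 𝕏 → 𝕏 → Fin d → ℝ} {W : ℝ} (hW0 : 0 ≤ W)
    (hW : ∀ s t b, |w s t ⬝ᵥ b| ≤ W * ‖b‖) {q : Fin n → Fin n → ℝ}
    (hq : ∀ i j, q i j ∈ Set.Icc (0 : ℝ) 1) (hn : 3 ≤ n) {i j : Fin n} (hij : i ≠ j)
    (x : Fin n → 𝕏) (β β' : Param d) (a : ℝ) :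
    |index w β x q a i j - index w β' x q a i j| ≤ (W + 2) * ‖β - β'‖ := by
  have hp := popularity_mem_Icc hq hn hij
  set p := ((n : ℝ) - 2)⁻¹ * (∑ k ∈ Finset.univ.filter (fun k => k ≠ i ∧ k ≠ j), q j k) with hpdef
  have h1 : index w β x q a i j - index w β' x q a i j
      = w (x i) (x j) ⬝ᵥ (β - β').1 + q j i * (β - β').2.1 + p * (β - β').2.2 := by
    simp only [index, Prod.fst_sub, Prod.snd_sub, dotProduct_sub, ← hpdef]; ring
  rw [h1]
  have e1 : |w (x i) (x j) ⬝ᵥ (β - β').1| ≤ W * ‖(β - β').1‖ := hW _ _ _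
  have e1' : W * ‖(β - β').1‖ ≤ W * ‖β - β'‖ := mul_le_mul_of_nonneg_left (norm_fst_le _) hW0
  have e2 : |q j i * (β - β').2.1| ≤ ‖β - β'‖ := by
    rw [abs_mul, abs_of_nonneg (hq j i).1]
    nlinarith [abs_reciprocity_le (β - β'), (hq j i).2, (hq j i).1, abs_nonneg (β - β').2.1]
  have e3 : |p * (β - β').2.2| ≤ ‖β - β'‖ := by
    rw [abs_mul, abs_of_nonneg hp.1]
    nlinarith [abs_popularity_le (β - β'), hp.2, hp.1, abs_nonneg (β - β').2.2]
  refine (abs_add_three _ _ _).trans ?_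
  linarith

lemma abs_index_le {w : 𝕏 → 𝕏 → Fin d → ℝ} {W : ℝ} (hW0 : 0 ≤ W)
    (hW : ∀ s t b, |w s t ⬝ᵥ b| ≤ W * ‖b‖) {q : Fin n → Fin n → ℝ}
    (hq : ∀ i j, q i j ∈ Set.Icc (0 : ℝ) 1) (hn : 3 ≤ n) {i j : Fin n} (hij : i ≠ j)
    (x : Fin n → 𝕏) (β : Param d) (a : ℝ) :
    |index w β x q a i j| ≤ (W + 2) * ‖β‖ + |a| := by
  have h := abs_index_sub_le hW0 hW hq hn hij x β 0 a
  have h0 : index w 0 x q a i j = a := by simp [index]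
  rw [h0, sub_zero] at h
  calc |index w β x q a i j| = |(index w β x q a i j - a) + a| := by ring_nf
    _ ≤ _ := (abs_add_le _ _).trans (by linarith)

/-- If two matrices of link probabilities are close in every column, then the indices they
generate are close on average in every row. -/
lemma sum_abs_index_sub_le (w : 𝕏 → 𝕏 → Fin d → ℝ) {q q' : Fin n → Fin n → ℝ} {K : ℝ}
    (hK : ∀ l, ∑ k ∈ Finset.univ.erase l, |q' k l - q k l| ≤ K) (hn : 3 ≤ n)
    (x : Fin n → 𝕏) (β : Param d) (a : ℝ) (i : Fin n) :
    ∑ j ∈ Finset.univ.erase i, |index w β x q' a i j - index w β x q a i j| ≤ 4 * K * ‖β‖ := by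
  have hn3 : (3 : ℝ) ≤ n := by exact_mod_cast hn
  have hn' : (0 : ℝ) < (n : ℝ) - 2 := by linarith
  have hK0 : 0 ≤ K := le_trans (Finset.sum_nonneg fun _ _ => abs_nonneg _) (hK i)
  have hterm : ∀ j, |index w β x q' a i j - index w β x q a i j| ≤ ‖β‖ * (|q' j i - q j i|
      + ((n : ℝ) - 2)⁻¹ * ∑ k ∈ Finset.univ.filter (fun k => k ≠ i ∧ k ≠ j), |q' j k - q j k|) := by
    intro j
    have h1 : index w β x q' a i j - index w β x q a i j = (q' j i - q j i) * β.2.1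
        + ((n : ℝ) - 2)⁻¹ *
          (∑ k ∈ Finset.univ.filter (fun k => k ≠ i ∧ k ≠ j), (q' j k - q j k)) * β.2.2 := by
      simp only [index, Finset.sum_sub_distrib]; ring
    rw [h1]
    refine (abs_add_le _ _).trans ?_
    rw [abs_mul, abs_mul, abs_mul, abs_of_pos (inv_pos.2 hn')]
    have h2 : |∑ k ∈ Finset.univ.filter (fun k => k ≠ i ∧ k ≠ j), (q' j k - q j k)|
        ≤ ∑ k ∈ Finset.univ.filter (fun k => k ≠ i ∧ k ≠ j), |q' j k - q j k| :=
      Finset.abs_sum_le_sum_abs _ _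
    have h3 := mul_le_mul_of_nonneg_left (abs_reciprocity_le β) (abs_nonneg (q' j i - q j i))
    have h4 := mul_le_mul (mul_le_mul_of_nonneg_left h2 (inv_pos.2 hn').le) (abs_popularity_le β)
      (abs_nonneg _) (mul_nonneg (inv_pos.2 hn').le (Finset.sum_nonneg fun _ _ => abs_nonneg _))
    linarith
  -- Dropping the restrictions leaves a sum over all ordered pairs, which splits into `n` columns.
  have hdouble : ∑ j ∈ Finset.univ.erase i,
      ∑ k ∈ Finset.univ.filter (fun k => k ≠ i ∧ k ≠ j), |q' j k - q j k| ≤ n * K := by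
    calc _ ≤ ∑ j, ∑ k ∈ Finset.univ.erase j, |q' j k - q j k| := by
          refine (Finset.sum_le_sum fun j _ => ?_).trans
            (Finset.sum_le_sum_of_subset_of_nonneg (Finset.subset_univ _)
              fun _ _ _ => Finset.sum_nonneg fun _ _ => abs_nonneg _)
          refine Finset.sum_le_sum_of_subset_of_nonneg ?_ fun _ _ _ => abs_nonneg _
          intro k hk
          simp only [Finset.mem_filter, Finset.mem_univ, true_and] at hk
          simp [hk.2]
      _ = ∑ k, ∑ j ∈ Finset.univ.erase k, |q' j k - q j k| := by
          refine Finset.sum_comm' fun j k => ?_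
          simp [eq_comm]
      _ ≤ ∑ _k : Fin n, K := Finset.sum_le_sum fun k _ => hK k
      _ = n * K := by simp
  calc _ ≤ ∑ j ∈ Finset.univ.erase i, ‖β‖ * (|q' j i - q j i| + ((n : ℝ) - 2)⁻¹ *
          ∑ k ∈ Finset.univ.filter (fun k => k ≠ i ∧ k ≠ j), |q' j k - q j k|) :=
        Finset.sum_le_sum fun j _ => hterm j
    _ = ‖β‖ * (∑ j ∈ Finset.univ.erase i, |q' j i - q j i| + ((n : ℝ) - 2)⁻¹ *
          ∑ j ∈ Finset.univ.erase i,
            ∑ k ∈ Finset.univ.filter (fun k => k ≠ i ∧ k ≠ j), |q' j k - q j k|) := by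
        rw [← Finset.mul_sum, Finset.sum_add_distrib, ← Finset.mul_sum]
    _ ≤ ‖β‖ * (K + ((n : ℝ) - 2)⁻¹ * (n * K)) := by
        refine mul_le_mul_of_nonneg_left ?_ (norm_nonneg _)
        exact add_le_add (hK i) (mul_le_mul_of_nonneg_left hdouble (inv_pos.2 hn').le)
    _ ≤ ‖β‖ * (4 * K) := by
        refine mul_le_mul_of_nonneg_left ?_ (norm_nonneg _)
        -- `n / (n - 2) ≤ 3` from `n = 3` on; with the reciprocity term this makes `4 K`.
        have : ((n : ℝ) - 2)⁻¹ * (n * K) ≤ 3 * K := by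
          rw [inv_mul_le_iff₀ hn']; nlinarith
        linarith
    _ = _ := by ring

/-! ### Link probabilities as functions of attributes -/

/-- Link probabilities that agree for pairs with the same attributes are a function of the
attributes. -/
lemma exists_eq_of_attributes {x : Fin n → 𝕏} {q : Fin n → Fin n → ℝ}
    (h : ∀ i j k l, i ≠ j → k ≠ l → x i = x k → x j = x l → q i j = q k l) :
    ∃ qt : 𝕏 → 𝕏 → ℝ, ∀ i j, i ≠ j → q i j = qt (x i) (x j) := by
  classical
  -- The value is read off at any representative pair; `0` is a dummy for attribute pairs that no
  -- two distinct agents realize.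
  refine ⟨fun s t => if hst : ∃ p : Fin n × Fin n, p.1 ≠ p.2 ∧ x p.1 = s ∧ x p.2 = t
    then q hst.choose.1 hst.choose.2 else 0, fun i j hij => ?_⟩
  have hex : ∃ p : Fin n × Fin n, p.1 ≠ p.2 ∧ x p.1 = x i ∧ x p.2 = x j := ⟨(i, j), hij, rfl, rfl⟩
  simp only [dif_pos hex]
  obtain ⟨h1, h2, h3⟩ := hex.choose_spec
  exact h i j _ _ hij h1 h2.symm h3.symm

/-- If link probabilities depend only on attributes, then so do indices. -/
lemma index_congr (w : 𝕏 → 𝕏 → Fin d → ℝ) (β : Param d) {x : Fin n → 𝕏}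
    {q : Fin n → Fin n → ℝ} {qt : 𝕏 → 𝕏 → ℝ} (hqt : ∀ i j, i ≠ j → q i j = qt (x i) (x j))
    (a : ℝ) {i j k l : Fin n} (hij : i ≠ j) (hkl : k ≠ l) (hik : x i = x k) (hjl : x j = x l) :
    index w β x q a i j = index w β x q a k l := by
  -- Restoring the two missing terms turns the popularity sum into a full sum, which no longer
  -- depends on the identities of the agents. The term `qt (x j) (x j)` is formal and need not equal
  -- `q j j`.
  have hsum : ∀ i j : Fin n, i ≠ j → ∑ m ∈ Finset.univ.filter (fun m => m ≠ i ∧ m ≠ j), q j m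
      = ∑ m, qt (x j) (x m) - qt (x j) (x i) - qt (x j) (x j) := by
    intro i j hij
    have h1 : Finset.univ.filter (fun k : Fin n => k ≠ i ∧ k ≠ j)
        = (Finset.univ.erase i).erase j := by ext k; simp [and_comm]
    rw [h1, ← Finset.sum_erase_eq_sub (Finset.mem_univ i),
      ← Finset.sum_erase_eq_sub (by simp [hij.symm])]
    refine Finset.sum_congr rfl fun m hm => hqt j m ?_
    exact (Finset.ne_of_mem_erase hm).symm
  unfold index
  rw [hsum i j hij, hsum k l hkl, hqt j i hij.symm, hqt l k hkl.symm, hik, hjl]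

/-- A weighted sum whose weights depend only on an attribute is small if all attribute-wise
sums are. -/
lemma abs_sum_mul_le_of_fiberwise {ι : Type*} [Fintype 𝕏] [DecidableEq 𝕏] (s : Finset ι)
    (x : ι → 𝕏) {f z : ι → ℝ} {M b : ℝ} (hM : 0 ≤ M)
    (hz : ∀ j ∈ s, ∀ k ∈ s, x j = x k → z j = z k) (hzM : ∀ j ∈ s, |z j| ≤ M)
    (hf : ∀ t, |∑ j ∈ s with x j = t, f j| ≤ b) :
    |∑ j ∈ s, f j * z j| ≤ Fintype.card 𝕏 * (M * b) := by
  rw [← Finset.sum_fiberwise s x]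
  refine (Finset.abs_sum_le_sum_abs _ _).trans ?_
  rw [← nsmul_eq_mul]
  refine Finset.sum_le_card_nsmul _ _ _ fun t _ => ?_
  rcases Finset.eq_empty_or_nonempty (s.filter (fun j => x j = t)) with h | ⟨j₀, hj₀⟩
  · rw [h, Finset.sum_empty, abs_zero]
    exact mul_nonneg hM ((abs_nonneg _).trans (hf t))
  · rw [Finset.mem_filter] at hj₀
    have : ∑ j ∈ s with x j = t, f j * z j = (∑ j ∈ s with x j = t, f j) * z j₀ := by
      rw [Finset.sum_mul]
      refine Finset.sum_congr rfl fun j hj => ?_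
      rw [Finset.mem_filter] at hj
      rw [hz j hj.1 j₀ hj₀.1 (hj.2.trans hj₀.2.symm)]
    rw [this, abs_mul, mul_comm]
    exact mul_le_mul (hzM j₀ hj₀.1) (hf t) (abs_nonneg _) hM

/-- A realization in which the laws of large numbers hold up to `ε`: those for the link
indicators, in rows and in columns, and those for the private types. -/
structure IsTypical [DecidableEq 𝕏] (w : 𝕏 → 𝕏 → Fin d → ℝ) (β₀ : Param d) (x : Fin n → 𝕏)
    (A : Fin n → ℝ) (g : Network n) (q : Fin n → Fin n → ℝ) (ε : ℝ) : Prop where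
  mem_Icc : ∀ i j, q i j ∈ Set.Icc (0 : ℝ) 1
  of_attributes : ∃ qt : 𝕏 → 𝕏 → ℝ, ∀ i j, i ≠ j → q i j = qt (x i) (x j)
  column : ∀ l s, |∑ k ∈ Finset.univ.erase l with x k = s,
    (link g k l - choiceProb w β₀ x q (A k) k l)| ≤ ε * n
  row : ∀ i t, |∑ j ∈ Finset.univ.erase i with x j = t,
    (link g i j - choiceProb w β₀ x q (A i) i j)| ≤ ε * n
  type : ∀ i j, i ≠ j → |∑ k with x k = x i,
    (Real.sigmoid (index w β₀ x q (A k) i j) - q i j)| ≤ ε * n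

/-- Column-wise order of summation, because links in one column can be compared with a single `q k₀
l`. -/
lemma sum_pairs_eq [DecidableEq 𝕏] (x : Fin n → 𝕏) (s t : 𝕏) (f : Fin n → Fin n → ℝ) :
    (∑ i, ∑ j ∈ Finset.univ.erase i, if x i = s ∧ x j = t then f i j else 0)
      = ∑ j with x j = t, ∑ i ∈ Finset.univ.erase j with x i = s, f i j := by
  rw [Finset.sum_comm' (t' := Finset.univ) (s' := fun j => Finset.univ.erase j)
    (by intro i j; simp [eq_comm]), Finset.sum_filter]
  refine Finset.sum_congr rfl fun j _ => ?_
  rw [Finset.sum_filter]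
  split_ifs with h
  · simp [h]
  · simp [h]

/-- Removing the target costs one agent exactly when its attribute is `s`, which is the same for
both targets. The frequency is thus an average of columns of equal length. -/
lemma card_erase_filter_eq [DecidableEq 𝕏] {x : Fin n → 𝕏} (s : 𝕏) {j l : Fin n}
    (h : x j = x l) : ((Finset.univ.erase j).filter (fun i => x i = s)).card
      = ((Finset.univ.erase l).filter (fun i => x i = s)).card := by
  rw [Finset.filter_erase, Finset.filter_erase]
  by_cases hs : x j = s
  · rw [Finset.card_erase_of_mem (by simp [hs]), Finset.card_erase_of_mem (by simp [← h, hs])]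
  · rw [Finset.erase_eq_of_notMem (by simp [hs]), Finset.erase_eq_of_notMem (by simp [← h, hs])]

lemma frequency_mem_Icc [DecidableEq 𝕏] (x : Fin n → 𝕏) (g : Network n) (s t : 𝕏) :
    frequency x g s t ∈ Set.Icc (0 : ℝ) 1 := by
  unfold frequency
  have hnum : 0 ≤ ∑ i, ∑ j ∈ Finset.univ.erase i, if x i = s ∧ x j = t then link g i j else 0 :=
    Finset.sum_nonneg fun i _ => Finset.sum_nonneg fun j _ => by
      split_ifs; exacts [link_nonneg _ _ _, le_rfl]
  have hden : 0 ≤ ∑ i : Fin n, ∑ j ∈ Finset.univ.erase i,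
      if x i = s ∧ x j = t then (1 : ℝ) else 0 :=
    Finset.sum_nonneg fun i _ => Finset.sum_nonneg fun j _ => by
      split_ifs <;> norm_num
  refine ⟨div_nonneg hnum hden, div_le_one_of_le₀ ?_ hden⟩
  refine Finset.sum_le_sum fun i _ => Finset.sum_le_sum fun j _ => ?_
  split_ifs; exacts [link_le_one _ _ _, le_rfl]

/-- In a typical realization the first-step estimates are close to the link probabilities, on
average in every column. -/
lemma IsTypical.sum_abs_qHat_sub_le [Fintype 𝕏] [DecidableEq 𝕏] {w : 𝕏 → 𝕏 → Fin d → ℝ}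
    {β₀ : Param d} {x : Fin n → 𝕏} {A : Fin n → ℝ} {g : Network n} {q : Fin n → Fin n → ℝ} {ε : ℝ}
    (h : IsTypical w β₀ x A g q ε) (l : Fin n) :
    ∑ k ∈ Finset.univ.erase l, |qHat x g k l - q k l| ≤ Fintype.card 𝕏 * (2 * ε * n + 1) := by
  obtain ⟨qt, hqt⟩ := h.of_attributes
  rw [← Finset.sum_fiberwise _ x, ← nsmul_eq_mul]
  refine Finset.sum_le_card_nsmul _ _ _ fun s _ => ?_
  have hεn : 0 ≤ ε * n := (abs_nonneg _).trans (h.column l s)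
  rcases Finset.eq_empty_or_nonempty ((Finset.univ.erase l).filter (fun k => x k = s))
    with he | ⟨k₀, hk₀⟩
  · rw [he, Finset.sum_empty]; linarith
  simp only [Finset.mem_filter, Finset.mem_erase, Finset.mem_univ, and_true] at hk₀
  obtain ⟨hkl, rfl⟩ := hk₀
  set S : Fin n → Finset (Fin n) := fun j => (Finset.univ.erase j).filter (fun k => x k = x k₀)
    with hS
  set T : Finset (Fin n) := Finset.univ.filter (fun j => x j = x l) with hT
  have hl : l ∈ T := by simp [hT]
  set m : ℝ := ((S l).card : ℝ) with hm
  have hm0 : 0 < m := by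
    have : k₀ ∈ S l := by simp [hS, hkl]
    exact Nat.cast_pos.2 (Finset.card_pos.2 ⟨_, this⟩)
  have hT0 : (0 : ℝ) < T.card := by exact_mod_cast Finset.card_pos.2 ⟨_, hl⟩
  have hcard : ∀ j ∈ T, ((S j).card : ℝ) = m := by
    intro j hj
    exact congrArg Nat.cast (card_erase_filter_eq (x k₀) (by simpa [hT] using hj))
  -- Estimate and target are both constant on a fiber, so the fiber contributes its size times one
  -- error.
  have hconst : ∑ k ∈ S l, |qHat x g k l - q k l|
      = m * |frequency x g (x k₀) (x l) - q k₀ l| := by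
    rw [hm, ← nsmul_eq_mul, ← Finset.sum_const]
    refine Finset.sum_congr rfl fun k hk => ?_
    simp only [hS, Finset.mem_filter, Finset.mem_erase, Finset.mem_univ, and_true] at hk
    rw [qHat, hk.2, hqt k l hk.1, hqt k₀ l hkl, hk.2]
  have hfreq : frequency x g (x k₀) (x l) = (∑ j ∈ T, ∑ i ∈ S j, link g i j) / (T.card * m) := by
    rw [frequency, sum_pairs_eq, sum_pairs_eq x _ _ (fun _ _ => 1)]
    congr 1
    rw [← nsmul_eq_mul, ← Finset.sum_const]
    refine Finset.sum_congr rfl fun j hj => ?_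
    rw [← hcard j hj]; simp [hS]
  -- One `ε n` is sampling error of the links, the other is the deviation of the types; the `1` pays
  -- for agent `j`, who belongs to the type average but not to column `j`.
  have hcol : ∀ j ∈ T, |∑ i ∈ S j, (link g i j - q k₀ l)| ≤ 2 * ε * n + 1 := by
    intro j hj
    have hxj : x j = x l := by simpa [hT] using hj
    have h1 := h.column j (x k₀)
    have h2 := h.type k₀ l hkl
    have h3 : ∑ i ∈ S j, (link g i j - q k₀ l)
        = ∑ i ∈ S j, (link g i j - choiceProb w β₀ x q (A i) i j)
          + ∑ i ∈ S j, (Real.sigmoid (index w β₀ x q (A i) k₀ l) - q k₀ l) := by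
      rw [← Finset.sum_add_distrib]
      refine Finset.sum_congr rfl fun i hi => ?_
      simp only [hS, Finset.mem_filter, Finset.mem_erase, Finset.mem_univ, and_true] at hi
      rw [choiceProb, index_congr w β₀ hqt (A i) hi.1 hkl hi.2 hxj]; ring
    have h4 : |∑ i ∈ S j, (Real.sigmoid (index w β₀ x q (A i) k₀ l) - q k₀ l)| ≤ ε * n + 1 := by
      by_cases hjs : x j = x k₀
      · have h5 : S j = (Finset.univ.filter (fun k => x k = x k₀)).erase j := by
          rw [hS]; exact Finset.filter_erase _ _ _
        rw [h5, Finset.sum_erase_eq_sub (by simp [hjs])]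
        refine (abs_sub _ _).trans (add_le_add h2 ?_)
        rw [abs_le]
        have := h.mem_Icc k₀ l
        have a1 := Real.sigmoid_nonneg (index w β₀ x q (A j) k₀ l)
        have a2 := Real.sigmoid_le_one (index w β₀ x q (A j) k₀ l)
        constructor <;> linarith [this.1, this.2]
      · have h5 : S j = Finset.univ.filter (fun k => x k = x k₀) := by
          rw [hS]; simp only [Finset.filter_erase]
          exact Finset.erase_eq_of_notMem (by simp [hjs])
        rw [h5]; linarith
    rw [h3]
    refine (abs_add_le _ _).trans ?_
    linarith
  rw [hconst, hfreq]
  have h6 : (∑ j ∈ T, ∑ i ∈ S j, link g i j) / (T.card * m) - q k₀ l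
      = (∑ j ∈ T, ∑ i ∈ S j, (link g i j - q k₀ l)) / (T.card * m) := by
    have : ∑ j ∈ T, ∑ i ∈ S j, (link g i j - q k₀ l)
        = ∑ j ∈ T, ∑ i ∈ S j, link g i j - T.card * m * q k₀ l := by
      simp only [Finset.sum_sub_distrib]
      congr 1
      rw [mul_assoc, ← nsmul_eq_mul, ← Finset.sum_const]
      refine Finset.sum_congr rfl fun j hj => ?_
      rw [← hcard j hj, Finset.sum_const, nsmul_eq_mul]
    rw [this, sub_div, mul_div_cancel_left₀ _ (by positivity)]
  rw [h6, abs_div, abs_of_pos (by positivity : (0 : ℝ) < T.card * m)]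
  have h7 : |∑ j ∈ T, ∑ i ∈ S j, (link g i j - q k₀ l)| ≤ T.card * (2 * ε * n + 1) := by
    refine (Finset.abs_sum_le_sum_abs _ _).trans ?_
    rw [← nsmul_eq_mul]
    exact Finset.sum_le_card_nsmul _ _ _ hcol
  -- The fiber size `m` cancels, so rare attributes do no harm.
  calc _ = |∑ j ∈ T, ∑ i ∈ S j, (link g i j - q k₀ l)| / T.card := by field_simp
    _ ≤ _ := by rw [div_le_iff₀ hT0]; linarith

lemma card_erase_univ (i : Fin n) : ((Finset.univ.erase i).card : ℝ) = (n : ℝ) - 1 := by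
  have h2 := Finset.card_erase_add_one (Finset.mem_univ i)
  rw [Finset.card_univ, Fintype.card_fin] at h2
  have : ((Finset.univ.erase i).card : ℝ) + 1 = n := by exact_mod_cast h2
  linarith

lemma abs_average_le {f : Fin n → ℝ} {b : ℝ} (hn : 3 ≤ n) (h : ∀ i, |f i| ≤ b) :
    |((n : ℝ) * ((n : ℝ) - 1))⁻¹ * ∑ i, f i| ≤ ((n : ℝ) - 1)⁻¹ * b := by
  have hn3 : (3 : ℝ) ≤ n := by exact_mod_cast hn
  have h0 : (0 : ℝ) < n := by linarith
  have h1 : (0 : ℝ) < (n : ℝ) - 1 := by linarith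
  rw [abs_mul, abs_of_pos (by positivity)]
  have : |∑ i, f i| ≤ n * b := by
    refine (Finset.abs_sum_le_sum_abs _ _).trans ?_
    refine (Finset.sum_le_card_nsmul _ _ _ fun i _ => h i).trans_eq ?_
    simp
  calc _ ≤ ((n : ℝ) * ((n : ℝ) - 1))⁻¹ * (n * b) := by gcongr
    _ = _ := by field_simp

/-! ### Consequences of typicality for the likelihood and its maximizers -/

section Typical

variable [Fintype 𝕏] [DecidableEq 𝕏] {w : 𝕏 → 𝕏 → Fin d → ℝ} {β₀ : Param d} {x : Fin n → 𝕏}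
  {A₀ : Fin n → ℝ} {g : Network n} {q : Fin n → Fin n → ℝ} {ε W R RA : ℝ}

/-- In a typical realization the feasible log-likelihood is uniformly close to the expected one. -/
lemma IsTypical.abs_logLik_sub_le (h : IsTypical w β₀ x A₀ g q ε) (hW0 : 0 ≤ W)
    (hW : ∀ s t b, |w s t ⬝ᵥ b| ≤ W * ‖b‖) (hn : 3 ≤ n) (hεn : 1 ≤ ε * n) {β : Param d}
    (hβ : ‖β‖ ≤ R) {A : Fin n → ℝ} (hA : ∀ i, |A i| ≤ RA) :
    |logLik w x g β A (qHat x g)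
        - logitLik (fun i j => choiceProb w β₀ x q (A₀ i) i j)
          (fun i j => index w β x q (A i) i j)|
      ≤ Fintype.card 𝕏 * (40 * R + 2 * ((W + 2) * R + RA)) * ε := by
  have hn3 : (3 : ℝ) ≤ n := by exact_mod_cast hn
  have h1 : (0 : ℝ) < (n : ℝ) - 1 := by linarith
  have hR : 0 ≤ R := (norm_nonneg _).trans hβ
  have hRA : 0 ≤ RA := (abs_nonneg _).trans (hA ⟨0, by omega⟩)
  obtain ⟨qt, hqt⟩ := h.of_attributes
  set N : ℝ := ((Fintype.card 𝕏 : ℕ) : ℝ) with hN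
  have hN0 : 0 ≤ N := by positivity
  have hε : 0 < ε := by
    by_contra hcon
    nlinarith
  set M := (W + 2) * R + RA with hM
  have hM0 : 0 ≤ M := by positivity
  rw [logLik_eq_logitLik, logitLik, logitLik, ← mul_sub, ← Finset.sum_sub_distrib]
  have hrow : ∀ i, |∑ j ∈ Finset.univ.erase i, (link g i j * index w β x (qHat x g) (A i) i j
        - softplus (index w β x (qHat x g) (A i) i j))
      - ∑ j ∈ Finset.univ.erase i, (choiceProb w β₀ x q (A₀ i) i j * index w β x q (A i) i j
        - softplus (index w β x q (A i) i j))|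
      ≤ 8 * (N * (2 * ε * n + 1)) * R + N * (M * (ε * n)) := by
    intro i
    -- Plug-in error from `q̂` in place of `q`, plus sampling error of the links at the true `q`.
    have e1 : ∑ j ∈ Finset.univ.erase i, (link g i j * index w β x (qHat x g) (A i) i j
        - softplus (index w β x (qHat x g) (A i) i j))
      - ∑ j ∈ Finset.univ.erase i, (choiceProb w β₀ x q (A₀ i) i j * index w β x q (A i) i j
        - softplus (index w β x q (A i) i j))
      = ∑ j ∈ Finset.univ.erase i,
          (link g i j * (index w β x (qHat x g) (A i) i j - index w β x q (A i) i j)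
          - (softplus (index w β x (qHat x g) (A i) i j) - softplus (index w β x q (A i) i j)))
        + ∑ j ∈ Finset.univ.erase i,
          (link g i j - choiceProb w β₀ x q (A₀ i) i j) * index w β x q (A i) i j := by
      rw [← Finset.sum_sub_distrib, ← Finset.sum_add_distrib]
      exact Finset.sum_congr rfl fun j _ => by ring
    rw [e1]
    refine (abs_add_le _ _).trans (add_le_add ?_ ?_)
    · have hK := sum_abs_index_sub_le w h.sum_abs_qHat_sub_le hn x β (A i) i
      calc _ ≤ ∑ j ∈ Finset.univ.erase i,
            -- One unit for the linear part, whose slope is a link in `[0, 1]`, and one for the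
            -- 1-Lipschitz `softplus`.
            2 * |index w β x (qHat x g) (A i) i j - index w β x q (A i) i j| := by
            refine (Finset.abs_sum_le_sum_abs _ _).trans (Finset.sum_le_sum fun j _ => ?_)
            refine (abs_sub _ _).trans ?_
            rw [abs_mul, abs_of_nonneg (link_nonneg g i j)]
            have b1 := abs_softplus_sub_le (index w β x (qHat x g) (A i) i j)
              (index w β x q (A i) i j)
            have b2 := mul_le_mul_of_nonneg_right (link_le_one g i j)
              (abs_nonneg (index w β x (qHat x g) (A i) i j - index w β x q (A i) i j))
            linarith
        _ ≤ 2 * (4 * (N * (2 * ε * n + 1)) * ‖β‖) := by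
            rw [← Finset.mul_sum]; linarith
        _ ≤ 2 * (4 * (N * (2 * ε * n + 1)) * R) := by gcongr
        _ = _ := by ring
    -- Along a row the index depends on `j` only through its attribute, so the row law applies fiber
    -- by fiber, uniformly in `β` and `A`.
    · refine abs_sum_mul_le_of_fiberwise _ x hM0 ?_ ?_ (h.row i)
      · intro j hj k hk hjk
        exact index_congr w β hqt (A i) (Finset.ne_of_mem_erase hj).symm
          (Finset.ne_of_mem_erase hk).symm rfl hjk
      · intro j hj
        refine (abs_index_le hW0 hW h.mem_Icc hn (Finset.ne_of_mem_erase hj).symm x β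
          (A i)).trans ?_
        exact add_le_add (mul_le_mul_of_nonneg_left hβ (by linarith)) (hA i)
  refine (abs_average_le hn hrow).trans ?_
  rw [inv_mul_le_iff₀ h1]
  have c1 : 2 * ε * n + 1 ≤ 3 * (ε * n) := by linarith
  have c2 : ε * n ≤ 3 / 2 * (ε * ((n : ℝ) - 1)) := by nlinarith
  have c3 : 0 ≤ ε * ((n : ℝ) - 1) := by positivity
  calc 8 * (N * (2 * ε * n + 1)) * R + N * (M * (ε * n))
      ≤ 8 * (N * (5 * (ε * ((n : ℝ) - 1)))) * R + N * (M * (2 * (ε * ((n : ℝ) - 1)))) := by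
        -- Uses `1 ≤ ε n` and `n ≤ 3 (n - 1) / 2`; this is the source of `40 = 8 · 5` in the bound.
        have d1 : 2 * ε * n + 1 ≤ 5 * (ε * ((n : ℝ) - 1)) := by linarith
        have d2 : ε * n ≤ 2 * (ε * ((n : ℝ) - 1)) := by linarith
        gcongr
    _ = _ := by ring

/-- In a typical realization, the estimates of all private types are close to the true ones as
soon as the estimate of the common parameter is. -/
lemma IsTypical.abs_type_sub_le (h : IsTypical w β₀ x A₀ g q ε) (hW0 : 0 ≤ W)
    (hW : ∀ s t b, |w s t ⬝ᵥ b| ≤ W * ‖b‖) (hn : 3 ≤ n) (hεn : 1 ≤ ε * n)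
    {B : Set (Param d)} {𝔸 : Set ℝ} (hB : ∀ β ∈ B, ‖β‖ ≤ R) (h𝔸 : ∀ a ∈ 𝔸, |a| ≤ RA)
    (hA₀ : ∀ i, A₀ i ∈ 𝔸) {β : Param d} {A : Fin n → ℝ} (hmle : IsTwoStepMLE w B 𝔸 x g β A)
    (i : Fin n) :
    curvature ((W + 2) * R + RA) / 2 * |A i - A₀ i|
      ≤ Fintype.card 𝕏 * (2 + 20 * R) * ε + (W + 2) * ‖β - β₀‖ := by
  have hn3 : (3 : ℝ) ≤ n := by exact_mod_cast hn
  have h1 : (0 : ℝ) < (n : ℝ) - 1 := by linarith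
  have h0 : (0 : ℝ) < n := by linarith
  obtain ⟨hβB, hA, hmax⟩ := hmle
  have hR : 0 ≤ R := (norm_nonneg _).trans (hB β hβB)
  set N : ℝ := ((Fintype.card 𝕏 : ℕ) : ℝ) with hN
  have hN0 : 0 ≤ N := by positivity
  set y : Fin n → ℝ := fun j => index w β x (qHat x g) 0 i j with hy
  have hyb : ∀ a ∈ 𝔸, ∀ j ∈ Finset.univ.erase i, |y j + a| ≤ (W + 2) * R + RA := by
    intro a ha j hj
    rw [hy, ← index_eq_add]
    refine (abs_index_le hW0 hW (fun k l => frequency_mem_Icc x g _ _) hn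
      (Finset.ne_of_mem_erase hj).symm x β a).trans ?_
    exact add_le_add (mul_le_mul_of_nonneg_left (hB β hβB) (by linarith)) (h𝔸 a ha)
  have hopt : ∑ j ∈ Finset.univ.erase i, (link g i j * (y j + A₀ i) - softplus (y j + A₀ i))
      ≤ ∑ j ∈ Finset.univ.erase i, (link g i j * (y j + A i) - softplus (y j + A i)) := by
    -- Deviation in the single coordinate `i`: all other rows of the likelihood cancel.
    have hm := hmax β hβB (Function.update A i (A₀ i)) (fun k => by
      rcases eq_or_ne k i with rfl | hk
      · simpa using hA₀ k
      · simpa [hk] using hA k)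
    rw [logLik_eq_logitLik, logLik_eq_logitLik, logitLik, logitLik,
      mul_le_mul_iff_right₀ (by positivity), ← Finset.add_sum_erase _ _ (Finset.mem_univ i),
      ← Finset.add_sum_erase (f := fun i => ∑ j ∈ Finset.univ.erase i,
        (link g i j * index w β x (qHat x g) (A i) i j
          - softplus (index w β x (qHat x g) (A i) i j))) _ (Finset.mem_univ i)] at hm
    have hrest : ∑ k ∈ Finset.univ.erase i, ∑ j ∈ Finset.univ.erase k,
        (link g k j * index w β x (qHat x g) (Function.update A i (A₀ i) k) k j
          - softplus (index w β x (qHat x g) (Function.update A i (A₀ i) k) k j))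
        = ∑ k ∈ Finset.univ.erase i, ∑ j ∈ Finset.univ.erase k,
        (link g k j * index w β x (qHat x g) (A k) k j
          - softplus (index w β x (qHat x g) (A k) k j)) := by
      refine Finset.sum_congr rfl fun k hk => ?_
      rw [Function.update_of_ne (Finset.ne_of_mem_erase hk)]
    rw [hrest] at hm
    have hm' := le_of_add_le_add_right hm
    rw [Function.update_self] at hm'
    simp only [hy, ← index_eq_add]
    exact hm'
  have hkey := abs_sub_mul_card_le_of_logit_le (Finset.univ.erase i) (M := (W + 2) * R + RA)
    (link g i) y (hyb _ (hA i)) (hyb _ (hA₀ i)) hopt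
  rw [card_erase_univ] at hkey
  -- The score at the true type is sampling noise of row `i` plus the effect of replacing `β₀` and
  -- `q` by their estimates.
  have hsplit : ∑ j ∈ Finset.univ.erase i, (link g i j - Real.sigmoid (y j + A₀ i))
      = ∑ j ∈ Finset.univ.erase i, (link g i j - choiceProb w β₀ x q (A₀ i) i j) * 1
        + ∑ j ∈ Finset.univ.erase i, (choiceProb w β₀ x q (A₀ i) i j
          - Real.sigmoid (index w β x (qHat x g) (A₀ i) i j)) := by
    rw [← Finset.sum_add_distrib]
    refine Finset.sum_congr rfl fun j _ => ?_
    simp only [hy, ← index_eq_add]; ring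
  have hb1 : |∑ j ∈ Finset.univ.erase i, (link g i j - choiceProb w β₀ x q (A₀ i) i j) * 1|
      ≤ N * (1 * (ε * n)) :=
    abs_sum_mul_le_of_fiberwise _ x zero_le_one (fun _ _ _ _ _ => rfl) (fun _ _ => by simp)
      (h.row i)
  have hb2 : |∑ j ∈ Finset.univ.erase i, (choiceProb w β₀ x q (A₀ i) i j
      - Real.sigmoid (index w β x (qHat x g) (A₀ i) i j))|
      ≤ 4 * (N * (2 * ε * n + 1)) * R + ((n : ℝ) - 1) * ((W + 2) * ‖β - β₀‖) := by
    have hK := sum_abs_index_sub_le w h.sum_abs_qHat_sub_le hn x β (A₀ i) i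
    have hKR : 4 * (N * (2 * ε * n + 1)) * ‖β‖ ≤ 4 * (N * (2 * ε * n + 1)) * R := by
      have : 0 ≤ 2 * ε * n + 1 := by linarith
      exact mul_le_mul_of_nonneg_left (hB β hβB) (by positivity)
    calc _ ≤ ∑ j ∈ Finset.univ.erase i,
          (|index w β x (qHat x g) (A₀ i) i j - index w β x q (A₀ i) i j|
            + (W + 2) * ‖β - β₀‖) := by
          refine (Finset.abs_sum_le_sum_abs _ _).trans (Finset.sum_le_sum fun j hj => ?_)
          have d1 := abs_index_sub_le hW0 hW h.mem_Icc hn (Finset.ne_of_mem_erase hj).symm x β β₀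
            (A₀ i)
          rw [abs_sub_comm]
          refine (abs_sigmoid_sub_le _ _).trans ?_
          refine (abs_sub_le _ (index w β x q (A₀ i) i j) _).trans ?_
          linarith
      _ ≤ _ := by
          rw [Finset.sum_add_distrib, Finset.sum_const, nsmul_eq_mul, card_erase_univ]
          linarith
  rw [hsplit] at hkey
  have hfin := hkey.trans ((abs_add_le _ _).trans (add_le_add hb1 hb2))
  have c2 : ε * n ≤ 3 / 2 * (ε * ((n : ℝ) - 1)) := by
    have : 0 < ε := by
      by_contra hcon
      nlinarith
    nlinarith
  have c4 : 0 ≤ ε * ((n : ℝ) - 1) := by linarith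
  have hfin2 : N * (1 * (ε * n))
      + (4 * (N * (2 * ε * n + 1)) * R + ((n : ℝ) - 1) * ((W + 2) * ‖β - β₀‖))
      ≤ N * (1 * (2 * (ε * ((n : ℝ) - 1))))
      + (4 * (N * (5 * (ε * ((n : ℝ) - 1)))) * R + ((n : ℝ) - 1) * ((W + 2) * ‖β - β₀‖)) := by
    have d1 : 2 * ε * n + 1 ≤ 5 * (ε * ((n : ℝ) - 1)) := by linarith
    have d2 : ε * n ≤ 2 * (ε * ((n : ℝ) - 1)) := by linarith
    gcongr
  refine le_of_mul_le_mul_left ?_ h1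
  calc _ = curvature ((W + 2) * R + RA) / 2 * (((n : ℝ) - 1) * |A i - A₀ i|) := by ring
    _ ≤ _ := hfin.trans hfin2
    _ = _ := by ring

end Typical

end Deterministic

/-! ### The logistic distribution -/

lemma logistic_Iic (t : ℝ) : logistic (Set.Iic t) = ENNReal.ofReal (Real.sigmoid t) := by
  have := logisticCDF.measure_Iic Real.tendsto_sigmoid_atBot t
  rw [sub_zero] at this
  exact this

lemma logistic_Ioi (t : ℝ) : logistic (Set.Ioi t) = ENNReal.ofReal (Real.sigmoid (-t)) := by
  have := logisticCDF.measure_Ioi Real.tendsto_sigmoid_atTop t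
  rw [Real.sigmoid_neg]
  exact this

lemma logistic_singleton (t : ℝ) : logistic {t} = 0 := by
  have h := logisticCDF.measure_singleton t
  have h2 : Function.leftLim logisticCDF t = logisticCDF t :=
    ContinuousWithinAt.leftLim_eq (f := Real.sigmoid) continuous_sigmoid.continuousWithinAt
  rw [h2, sub_self, ENNReal.ofReal_zero] at h
  exact h

lemma logistic_real_pos_add (v : ℝ) : logistic.real {t | 0 < v + t} = Real.sigmoid v := by
  have h : {t : ℝ | 0 < v + t} = Set.Ioi (-v) := by
    ext t; simp only [Set.mem_ofPred_eq, Set.mem_Ioi]; constructor <;> intro h <;> linarith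
  rw [h, measureReal_def, logistic_Ioi, neg_neg, ENNReal.toReal_ofReal (Real.sigmoid_nonneg _)]

/-- An inequality is enough for the logit formula: there the bounds for the two choices add up to
the total mass one. -/
lemma logistic_real_add_neg_le (v : ℝ) : logistic.real {t | v + t < 0} ≤ 1 - Real.sigmoid v := by
  have h : {t : ℝ | v + t < 0} ⊆ Set.Iic (-v) := by
    intro t ht
    simp only [Set.mem_ofPred_eq, Set.mem_Iic] at *; linarith
  refine (measureReal_mono h).trans_eq ?_
  rw [measureReal_def, logistic_Iic, ENNReal.toReal_ofReal (Real.sigmoid_nonneg _),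
    Real.sigmoid_neg]

/-! ### Expected payoffs and equilibrium link probabilities -/

section Game

variable {𝕏 : Type*} {d n : ℕ}

lemma sum_network_prod (m : (i : Fin n) → Action i → ℝ) :
    ∑ g : Network n, ∏ l, m l (g l) = ∏ l, ∑ h, m l h := by
  rw [Finset.prod_univ_sum, Fintype.piFinset_univ]

/-- The probability of the network `g` if agent `i` plays `gi` and the others mix independently
according to `m`. -/
def networkWeight (m : (i : Fin n) → Action i → ℝ) (i : Fin n) (gi : Action i)
    (g : Network n) : ℝ :=
  if g i = gi then ∏ l ∈ Finset.univ.erase i, m l (g l) else 0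

lemma networkWeight_eq_prod (m : (i : Fin n) → Action i → ℝ) (i : Fin n) (gi : Action i)
    (g : Network n) :
    networkWeight m i gi g
      = ∏ l, (Function.update m i (fun h => if h = gi then 1 else 0)) l (g l) := by
  rw [← Finset.mul_prod_erase _ _ (Finset.mem_univ i), Function.update_self, networkWeight,
    ite_mul, one_mul, zero_mul]
  refine if_congr Iff.rfl (Finset.prod_congr rfl fun l hl => ?_) rfl
  rw [Function.update_of_ne (Finset.ne_of_mem_erase hl)]

lemma sum_networkWeight {m : (i : Fin n) → Action i → ℝ} (hm : ∀ j, ∑ h, m j h = 1) (i : Fin n)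
    (gi : Action i) : ∑ g, networkWeight m i gi g = 1 := by
  simp_rw [networkWeight_eq_prod]
  rw [sum_network_prod]
  refine Finset.prod_eq_one fun l _ => ?_
  rcases eq_or_ne l i with rfl | hl
  · simp
  · rw [Function.update_of_ne hl, hm]

/-- The weight is a product over agents, so `φ` is absorbed into the factor of `j`, and every other
factor sums to one. -/
lemma sum_networkWeight_mul {m : (i : Fin n) → Action i → ℝ} (hm : ∀ j, ∑ h, m j h = 1)
    {i j : Fin n} (hij : j ≠ i) (gi : Action i) (φ : Action j → ℝ) :
    ∑ g, networkWeight m i gi g * φ (g j) = ∑ h, m j h * φ h := by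
  set m' := Function.update m i (fun h => if h = gi then 1 else 0) with hm'
  have h1 : ∀ g : Network n, networkWeight m i gi g * φ (g j)
      = ∏ l, (Function.update m' j (fun h => m' j h * φ h)) l (g l) := by
    intro g
    have h2 : ∏ l ∈ Finset.univ.erase j, (Function.update m' j (fun h => m' j h * φ h)) l (g l)
        = ∏ l ∈ Finset.univ.erase j, m' l (g l) :=
      Finset.prod_congr rfl fun l hl => by rw [Function.update_of_ne (Finset.ne_of_mem_erase hl)]
    rw [networkWeight_eq_prod, ← hm', ← Finset.mul_prod_erase _ _ (Finset.mem_univ j),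
      ← Finset.mul_prod_erase (f := fun l => Function.update m' j (fun h => m' j h * φ h) l (g l))
        _ (Finset.mem_univ j), h2, Function.update_self]
    ring
  simp_rw [h1]
  rw [sum_network_prod, Finset.prod_eq_single j]
  · rw [Function.update_self, hm', Function.update_of_ne hij]
  · intro l _ hl
    rw [Function.update_of_ne hl]
    rcases eq_or_ne l i with rfl | hl'
    · simp [hm']
    · rw [hm', Function.update_of_ne hl', hm]
  · simp

/-- The payoff of the action `g` if every proposed link `j` is worth `v j`. -/
def linearPayoff {i : Fin n} (v : Fin n → ℝ) (g : Action i) : ℝ :=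
  ∑ j, if g.1 j = true then v j else 0

variable {w : 𝕏 → 𝕏 → Fin d → ℝ} {β : Param d} {x : Fin n → 𝕏} {μA : Fin n → Measure ℝ}
  {σ : Belief n}

lemma IsEquilibrium.mem_Icc (h : IsEquilibrium w β x μA σ) (i : Fin n) (a : ℝ) (g : Action i) :
    σ i a g ∈ Set.Icc (0 : ℝ) 1 := by
  refine ⟨(h.1 i a).1 g, ?_⟩
  rw [← (h.1 i a).2]
  exact Finset.single_le_sum (fun g _ => (h.1 i a).1 g) (Finset.mem_univ g)

lemma IsEquilibrium.integrable [∀ j, IsProbabilityMeasure (μA j)] (h : IsEquilibrium w β x μA σ)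
    (hσ : ∀ i g, Measurable (fun a => σ i a g)) (i : Fin n) (g : Action i) :
    Integrable (fun a => σ i a g) (μA i) :=
  Integrable.of_mem_Icc 0 1 (hσ i g).aemeasurable (ae_of_all _ fun a => h.mem_Icc i a g)

lemma IsEquilibrium.linkProb_mem_Icc (h : IsEquilibrium w β x μA σ) (i j : Fin n) (a : ℝ) :
    linkProb σ i j a ∈ Set.Icc (0 : ℝ) 1 := by
  unfold linkProb
  constructor
  · refine Finset.sum_nonneg fun g _ => ?_
    split_ifs; exacts [(h.1 i a).1 g, le_rfl]
  · rw [← (h.1 i a).2]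
    refine Finset.sum_le_sum fun g _ => ?_
    split_ifs; exacts [le_rfl, (h.1 i a).1 g]

lemma IsEquilibrium.meanLinkProb_mem_Icc [∀ j, IsProbabilityMeasure (μA j)]
    (h : IsEquilibrium w β x μA σ) (i j : Fin n) :
    meanLinkProb μA σ i j ∈ Set.Icc (0 : ℝ) 1 := by
  unfold meanLinkProb
  refine ⟨integral_nonneg fun a => (h.linkProb_mem_Icc i j a).1, ?_⟩
  have h1 : ∀ᵐ a ∂μA i, ‖linkProb σ i j a‖ ≤ 1 := ae_of_all _ fun a => by
    rw [Real.norm_of_nonneg (h.linkProb_mem_Icc i j a).1]; exact (h.linkProb_mem_Icc i j a).2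
  have := norm_integral_le_of_norm_le_const h1
  simp only [probReal_univ, mul_one] at this
  exact (le_abs_self _).trans this

/-- Payoffs are linear in the actions of the others, so that only their mean link probabilities
enter expected payoffs. -/
lemma IsEquilibrium.expectedPayoff_eq [∀ j, IsProbabilityMeasure (μA j)]
    (h : IsEquilibrium w β x μA σ) (hσ : ∀ i g, Measurable (fun a => σ i a g))
    (i : Fin n) (a : ℝ) (e : Fin n → ℝ) (gi : Action i) :
    expectedPayoff w β x μA σ i a e gi
      = linearPayoff (fun j => index w β x (meanLinkProb μA σ) a i j + e j) gi := by
  -- From the viewpoint of `i`, agent `j` plays the mixture `m j` with the type averaged out.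
  set m : (i : Fin n) → Action i → ℝ := fun j h => ∫ t, σ j t h ∂(μA j) with hm
  have hm1 : ∀ j, ∑ h, m j h = 1 := by
    intro j
    rw [hm, ← integral_finsetSum _ (fun g _ => h.integrable hσ j g)]
    simp [(h.1 j _).2]
  have hq : ∀ j k, meanLinkProb μA σ j k = ∑ h, m j h * (if h.1 k = true then 1 else 0) := by
    intro j k
    unfold meanLinkProb linkProb
    rw [integral_finsetSum]
    · refine Finset.sum_congr rfl fun g _ => ?_
      split_ifs <;> simp [hm]
    · intro g _
      split_ifs
      exacts [h.integrable hσ j g, integrable_zero _ _ _]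
  have hlink : ∀ j k, j ≠ i →
      ∑ g, networkWeight m i gi g * link g j k = meanLinkProb μA σ j k := by
    intro j k hj
    rw [hq]
    exact sum_networkWeight_mul hm1 hj gi (fun h => if h.1 k = true then 1 else 0)
  have h1 : expectedPayoff w β x μA σ i a e gi = ∑ g, networkWeight m i gi g *
      ∑ j, (if gi.1 j = true then 1 else 0) * (index w β x (link g) a i j + e j) := by
    unfold expectedPayoff networkWeight
    refine Finset.sum_congr rfl fun g _ => ?_
    split_ifs with hg
    · simp only [payoff, link, hg, hm]
    · simp
  rw [h1]
  simp_rw [Finset.mul_sum]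
  rw [Finset.sum_comm, linearPayoff]
  refine Finset.sum_congr rfl fun j _ => ?_
  by_cases hj : gi.1 j = true
  · have hji : j ≠ i := by rintro rfl; rw [gi.2] at hj; cases hj
    simp only [hj, if_true, one_mul]
    unfold index
    have h2 : ∀ g : Network n, networkWeight m i gi g * (w (x i) (x j) ⬝ᵥ β.1 + a
        + link g j i * β.2.1 + ((n : ℝ) - 2)⁻¹ *
          (∑ k ∈ Finset.univ.filter (fun k => k ≠ i ∧ k ≠ j), link g j k) * β.2.2 + e j)
        = networkWeight m i gi g * (w (x i) (x j) ⬝ᵥ β.1 + a + e j)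
          + networkWeight m i gi g * link g j i * β.2.1
          + (∑ k ∈ Finset.univ.filter (fun k => k ≠ i ∧ k ≠ j),
              networkWeight m i gi g * link g j k) * (((n : ℝ) - 2)⁻¹ * β.2.2) := by
      intro g
      rw [← Finset.mul_sum]; ring
    simp_rw [h2]
    rw [Finset.sum_add_distrib, Finset.sum_add_distrib, ← Finset.sum_mul, ← Finset.sum_mul,
      ← Finset.sum_mul, sum_networkWeight hm1, hlink j i hji, Finset.sum_comm,
      Finset.sum_congr rfl fun k _ => hlink j k hji]
    ring
  · simp [hj]

/-- The action `g` with the proposal to `j` replaced by `b`. -/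
def Action.set {i : Fin n} (g : Action i) {j : Fin n} (hij : i ≠ j) (b : Bool) : Action i :=
  ⟨Function.update g.1 j b, by rw [Function.update_of_ne hij]; exact g.2⟩

lemma linearPayoff_set {i : Fin n} (v : Fin n → ℝ) (g : Action i) {j : Fin n} (hij : i ≠ j)
    (b : Bool) : linearPayoff v (g.set hij b)
      = (if b = true then v j else 0)
        + ∑ k ∈ Finset.univ.erase j, if g.1 k = true then v k else 0 := by
  rw [linearPayoff, ← Finset.add_sum_erase _ _ (Finset.mem_univ j)]
  congr 1
  · simp [Action.set]
  · refine Finset.sum_congr rfl fun k hk => ?_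
    simp [Action.set, Finset.ne_of_mem_erase hk]

lemma linearPayoff_eq_add {i : Fin n} (v : Fin n → ℝ) (g : Action i) (j : Fin n) :
    linearPayoff v g = (if g.1 j = true then v j else 0)
        + ∑ k ∈ Finset.univ.erase j, if g.1 k = true then v k else 0 := by
  rw [linearPayoff, ← Finset.add_sum_erase _ _ (Finset.mem_univ j)]

lemma measurable_linearPayoff {i : Fin n} (v : Fin n → ℝ) (g : Action i) :
    Measurable (fun e : Fin n → ℝ => linearPayoff (fun j => v j + e j) g) := by
  unfold linearPayoff
  refine Finset.measurable_sum _ fun j _ => ?_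
  split_ifs <;> fun_prop

lemma pi_logistic_real_eval {s : Set ℝ} (hs : MeasurableSet s) (j : Fin n) :
    (Measure.pi (fun _ : Fin n => logistic)).real {e | e j ∈ s} = logistic.real s := by
  have := (measurePreserving_eval (fun _ : Fin n => logistic) j).measure_preimage
    hs.nullMeasurableSet
  rw [measureReal_def, measureReal_def, ← this]; rfl

/-- In equilibrium, link probabilities have the logit form. -/
lemma IsEquilibrium.linkProb_eq [∀ j, IsProbabilityMeasure (μA j)]
    (h : IsEquilibrium w β x μA σ) (hσ : ∀ i g, Measurable (fun a => σ i a g))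
    {i j : Fin n} (hij : i ≠ j) (a : ℝ) :
    linkProb σ i j a = Real.sigmoid (index w β x (meanLinkProb μA σ) a i j) := by
  set v : Fin n → ℝ := fun j => index w β x (meanLinkProb μA σ) a i j with hv
  set U : Action i → Set (Fin n → ℝ) := fun g => {e | ∀ g', g' ≠ g →
    linearPayoff (fun j => v j + e j) g' < linearPayoff (fun j => v j + e j) g} with hU
  set ν := Measure.pi (fun _ : Fin n => logistic) with hν
  have hσU : ∀ g, σ i a g = ν.real (U g) := by
    intro g
    rw [h.2 i a g]
    simp only [h.expectedPayoff_eq hσ, hU, hv, hν]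
  have hUm : ∀ g, MeasurableSet (U g) := by
    intro g
    simp only [hU, Set.ofPred_forall]
    refine MeasurableSet.iInter fun g' => MeasurableSet.iInter fun _ => ?_
    exact measurableSet_lt (measurable_linearPayoff v g') (measurable_linearPayoff v g)
  have hdisj : Pairwise (Function.onFun Disjoint U) := by
    intro g g' hgg'
    refine Set.disjoint_left.2 fun e he he' => ?_
    exact lt_asymm (he g' hgg'.symm) (he' g hgg')
  have hsum : ∀ b : Bool, ∑ g with g.1 j = b, σ i a g = ν.real (⋃ g ∈ Finset.univ.filter
      (fun g : Action i => g.1 j = b), U g) := by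
    intro b
    rw [measureReal_biUnion_finset (fun g _ g' _ hgg' => hdisj hgg') (fun g _ => hUm g)]
    exact Finset.sum_congr rfl fun g _ => hσU g
  -- If a strict best reply contains `j`, deleting that link must hurt, so the link has positive
  -- value.
  have htrue : ∑ g with g.1 j = true, σ i a g ≤ Real.sigmoid (v j) := by
    rw [hsum, ← logistic_real_pos_add, ← pi_logistic_real_eval (n := n) (j := j)
      (s := {t | 0 < v j + t}) (measurableSet_lt (by fun_prop) (by fun_prop))]
    refine measureReal_mono ?_
    refine Set.iUnion₂_subset fun g hg e he => ?_
    have hg' : g.1 j = true := by simpa using hg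
    have := he (g.set hij false) (fun hc => by
      have := congrArg (fun g => g.1 j) hc
      simp [Action.set, hg'] at this)
    rw [linearPayoff_set, linearPayoff_eq_add _ g j, hg'] at this
    simpa using this
  have hfalse : ∑ g with g.1 j = false, σ i a g ≤ 1 - Real.sigmoid (v j) := by
    refine le_trans ?_ (logistic_real_add_neg_le (v j))
    rw [hsum, ← pi_logistic_real_eval (n := n) (j := j)
      (s := {t | v j + t < 0}) (measurableSet_lt (by fun_prop) (by fun_prop))]
    refine measureReal_mono ?_
    refine Set.iUnion₂_subset fun g hg e he => ?_
    have hg' : g.1 j = false := by simpa using hg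
    have := he (g.set hij true) (fun hc => by
      have := congrArg (fun g => g.1 j) hc
      simp [Action.set, hg'] at this)
    rw [linearPayoff_set, linearPayoff_eq_add _ g j, hg'] at this
    simpa using this
  -- Both one-sided bounds must be attained, since bounds and probabilities alike sum to one.
  have htot : ∑ g with g.1 j = true, σ i a g + ∑ g with g.1 j = false, σ i a g = 1 := by
    rw [← (h.1 i a).2,
      ← Finset.sum_filter_add_sum_filter_not Finset.univ (fun g : Action i => g.1 j = true)]
    simp only [Bool.not_eq_true]
  rw [linkProb, ← Finset.sum_filter]
  linarith

/-- A best reply proposes the links of positive value and no links of negative value. -/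
lemma link_eq_of_best_reply {v : Fin n → ℝ} {g : Network n} {i j : Fin n} (hij : i ≠ j)
    (hbr : ∀ g' : Action i, linearPayoff v g' ≤ linearPayoff v (g i)) (hv : v j ≠ 0) :
    link g i j = if 0 < v j then 1 else 0 := by
  unfold link
  cases hg : (g i).1 j
  · have := hbr ((g i).set hij true)
    rw [linearPayoff_set, linearPayoff_eq_add _ (g i) j, hg] at this
    have h2 : v j ≤ 0 := by simpa using this
    simp [h2]
  · have := hbr ((g i).set hij false)
    rw [linearPayoff_set, linearPayoff_eq_add _ (g i) j, hg] at this
    have h2 : 0 ≤ v j := by simpa using this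
    simp [lt_of_le_of_ne h2 hv.symm]

end Game

/-! ### Concentration -/

/-- **Hoeffding's inequality** for a sum of centered functions of independent coordinates. -/
lemma measure_pi_abs_sum_ge_le {n : ℕ} {E : Fin n → Type*} [∀ i, MeasurableSpace (E i)]
    (μ : (i : Fin n) → Measure (E i)) [∀ i, IsProbabilityMeasure (μ i)] {φ : (i : Fin n) → E i → ℝ}
    (hφ : ∀ i, Measurable (φ i)) (hφb : ∀ i e, φ i e ∈ Set.Icc (-1 : ℝ) 1)
    (hφ0 : ∀ i, ∫ e, φ i e ∂(μ i) = 0) {ε : ℝ} (hε : 0 ≤ ε) :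
    (Measure.pi μ).real {e | ε * n ≤ |∑ i, φ i (e i)|} ≤ 2 * Real.exp (-(ε ^ 2 * n / 2)) := by
  have key : ∀ ψ : (i : Fin n) → E i → ℝ, (∀ i, Measurable (ψ i)) →
      (∀ i e, ψ i e ∈ Set.Icc (-1 : ℝ) 1) → (∀ i, ∫ e, ψ i e ∂(μ i) = 0) →
      (Measure.pi μ).real {e | ε * n ≤ ∑ i, ψ i (e i)} ≤ Real.exp (-(ε ^ 2 * n / 2)) := by
    intro ψ hψ hψb hψ0
    have hind : iIndepFun (fun i (e : (i : Fin n) → E i) => ψ i (e i)) (Measure.pi μ) :=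
      iIndepFun_pi fun i => (hψ i).aemeasurable
    have hsub : ∀ i ∈ Finset.univ, HasSubgaussianMGF (fun e : (i : Fin n) → E i => ψ i (e i)) 1
        (Measure.pi μ) := by
      intro i _
      have h0 : ∫ e, ψ i (e i) ∂(Measure.pi μ) = 0 := by
        rw [← hψ0 i]
        exact integral_comp_eval (hψ i).aestronglyMeasurable
      have := hasSubgaussianMGF_of_mem_Icc_of_integral_eq_zero (a := -1) (b := 1)
        (X := fun e : (i : Fin n) → E i => ψ i (e i)) (μ := Measure.pi μ)
        ((hψ i).comp (measurable_pi_apply i)).aemeasurable (ae_of_all _ fun e => hψb i (e i)) h0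
      -- The variance proxy for values in `[-1, 1]` is the squared half-length, hence `1`.
      convert this using 1
      ext; norm_num
    have := HasSubgaussianMGF.measure_sum_ge_le_of_iIndepFun hind hsub
      (ε := ε * n) (by positivity)
    refine this.trans_eq ?_
    congr 1
    rcases Nat.eq_zero_or_pos n with rfl | hn
    · simp
    · have : (n : ℝ) ≠ 0 := by positivity
      simp; field_simp
  have hsplit : {e : (i : Fin n) → E i | ε * n ≤ |∑ i, φ i (e i)|}
      ⊆ {e | ε * n ≤ ∑ i, φ i (e i)} ∪ {e | ε * n ≤ ∑ i, -φ i (e i)} := by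
    intro e he
    rcases le_abs.1 (show ε * n ≤ |∑ i, φ i (e i)| from he) with h | h
    · exact Or.inl h
    · right; simpa [Finset.sum_neg_distrib] using h
  calc _ ≤ _ := measureReal_mono hsplit
    _ ≤ _ := measureReal_union_le _ _
    _ ≤ Real.exp (-(ε ^ 2 * n / 2)) + Real.exp (-(ε ^ 2 * n / 2)) := by
        refine add_le_add (key φ hφ hφb hφ0) (key (fun i e => -φ i e) (fun i => (hφ i).neg) ?_ ?_)
        · intro i e
          have := hφb i e
          constructor <;> linarith [this.1, this.2]
        · intro i; rw [integral_neg, hφ0, neg_zero]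
    _ = _ := by ring

/-- The link indicator minus its probability, for the shock `t` and the index `v`. -/
def centeredLink (v t : ℝ) : ℝ := (if 0 < v + t then 1 else 0) - Real.sigmoid v

lemma measurable_centeredLink : Measurable (fun p : ℝ × ℝ => centeredLink p.1 p.2) := by
  unfold centeredLink
  refine Measurable.sub (Measurable.ite ?_ measurable_const measurable_const)
    (continuous_sigmoid.measurable.comp measurable_fst)
  exact measurableSet_lt measurable_const (measurable_fst.add measurable_snd)

lemma centeredLink_mem_Icc (v t : ℝ) : centeredLink v t ∈ Set.Icc (-1 : ℝ) 1 := by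
  unfold centeredLink
  have h0 := Real.sigmoid_nonneg v
  have h1 := Real.sigmoid_le_one v
  split_ifs <;> constructor <;> linarith

lemma integral_centeredLink (v : ℝ) : ∫ t, centeredLink v t ∂logistic = 0 := by
  have hm : MeasurableSet {t : ℝ | 0 < v + t} := measurableSet_lt (by fun_prop) (by fun_prop)
  have h1 : (fun t => if 0 < v + t then (1 : ℝ) else 0)
      = Set.indicator {t : ℝ | 0 < v + t} (fun _ => 1) := by
    ext t; simp [Set.indicator_apply]
  unfold centeredLink
  rw [integral_sub, h1, integral_indicator_const _ hm, logistic_real_pos_add]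
  · simp
  · rw [h1]; exact (integrable_const _).indicator hm
  · exact integrable_const _

lemma mul_mem_Icc_neg_one_one {c y : ℝ} (hc : c ∈ Set.Icc (0 : ℝ) 1)
    (hy : y ∈ Set.Icc (-1 : ℝ) 1) : c * y ∈ Set.Icc (-1 : ℝ) 1 := by
  constructor <;> nlinarith [hc.1, hc.2, hy.1, hy.2]

/-! ### Conditioning on the state -/

section Conditional

variable {Ω : Type*} [MeasurableSpace Ω] {P : Measure Ω} [IsProbabilityMeasure P]

/-- A bound for all conditional probabilities given `Y` is a bound for the probability. -/
lemma measure_le_of_indepFun {𝒴 ℰ : Type*} [MeasurableSpace 𝒴] [MeasurableSpace ℰ]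
    {Y : Ω → 𝒴} {e : Ω → ℰ} (hY : Measurable Y) (he : Measurable e) (hind : IndepFun e Y P)
    {s : Set (𝒴 × ℰ)} (hs : MeasurableSet s) {b : ENNReal}
    (hb : ∀ y, P.map e {t | (y, t) ∈ s} ≤ b) : P {ω | (Y ω, e ω) ∈ s} ≤ b := by
  have : IsProbabilityMeasure (P.map Y) := Measure.isProbabilityMeasure_map hY.aemeasurable
  have : IsProbabilityMeasure (P.map e) := Measure.isProbabilityMeasure_map he.aemeasurable
  have h1 := (indepFun_iff_map_prod_eq_prod_map_map hY.aemeasurable he.aemeasurable).1 hind.symm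
  have h2 : P {ω | (Y ω, e ω) ∈ s} = P.map (fun ω => (Y ω, e ω)) s :=
    (Measure.map_apply (hY.prodMk he) hs).symm
  rw [h2, h1, Measure.prod_apply hs]
  calc _ ≤ ∫⁻ _, b ∂(P.map Y) := lintegral_mono fun y => hb y
    _ = b := by simp

variable {n : ℕ} {𝒴 : Type*} [MeasurableSpace 𝒴] {Y : Ω → 𝒴} {e : Ω → Fin n → Fin n → ℝ}

/-- With the state frozen, the entries of column `l` lie in different rows of the shock matrix and
are independent by the outer product structure. The weights `c` will select the agents with a given
attribute. -/
lemma measure_column_le (hY : Measurable Y) (he : Measurable e) (hind : IndepFun e Y P)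
    (hlaw : P.map e = Measure.pi (fun _ => Measure.pi (fun _ => logistic)))
    {u : 𝒴 → Fin n → Fin n → ℝ} (hu : ∀ i j, Measurable (fun y => u y i j))
    {c : 𝒴 → Fin n → ℝ} (hc : ∀ k, Measurable (fun y => c y k))
    (hc1 : ∀ y k, c y k ∈ Set.Icc (0 : ℝ) 1) (l : Fin n) {ε : ℝ} (hε : 0 ≤ ε) :
    P {ω | ε * n ≤ |∑ k, c (Y ω) k * centeredLink (u (Y ω) k l) (e ω k l)|}
      ≤ ENNReal.ofReal (2 * Real.exp (-(ε ^ 2 * n / 2))) := by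
  have hcl : ∀ k, Measurable (fun p : 𝒴 × (Fin n → Fin n → ℝ) =>
      centeredLink (u p.1 k l) (p.2 k l)) := fun k =>
    measurable_centeredLink.comp (((hu k l).comp measurable_fst).prodMk
      ((measurable_pi_apply l).comp ((measurable_pi_apply k).comp measurable_snd)))
  refine measure_le_of_indepFun hY he hind
    (s := {p | ε * n ≤ |∑ k, c p.1 k * centeredLink (u p.1 k l) (p.2 k l)|}) ?_ fun y => ?_
  · refine measurableSet_le measurable_const (Measurable.abs ?_)
    exact Finset.measurable_sum _ fun k _ => ((hc k).comp measurable_fst).mul (hcl k)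
  · rw [hlaw, ← ofReal_measureReal]
    refine ENNReal.ofReal_le_ofReal ?_
    refine measure_pi_abs_sum_ge_le (fun _ => Measure.pi (fun _ => logistic))
      (φ := fun k ek => c y k * centeredLink (u y k l) (ek l)) ?_ ?_ ?_ hε
    · intro k
      exact (measurable_centeredLink.comp
        (measurable_const.prodMk (measurable_pi_apply l))).const_mul _
    · intro k ek
      exact mul_mem_Icc_neg_one_one (hc1 y k) (centeredLink_mem_Icc _ _)
    · intro k
      rw [integral_const_mul, integral_comp_eval (μ := fun _ : Fin n => logistic)
        (f := fun t => centeredLink (u y k l) t), integral_centeredLink, mul_zero]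
      exact (measurable_centeredLink.comp
        (measurable_const.prodMk measurable_id)).aestronglyMeasurable

/-- With the state frozen, only row `i` of the shocks matters, and its entries are independent by
the inner product structure. -/
lemma measure_row_le (hY : Measurable Y) (he : Measurable e) (hind : IndepFun e Y P)
    (hlaw : P.map e = Measure.pi (fun _ => Measure.pi (fun _ => logistic)))
    {u : 𝒴 → Fin n → Fin n → ℝ} (hu : ∀ i j, Measurable (fun y => u y i j))
    {c : 𝒴 → Fin n → ℝ} (hc : ∀ k, Measurable (fun y => c y k))
    (hc1 : ∀ y k, c y k ∈ Set.Icc (0 : ℝ) 1) (i : Fin n) {ε : ℝ} (hε : 0 ≤ ε) :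
    P {ω | ε * n ≤ |∑ j, c (Y ω) j * centeredLink (u (Y ω) i j) (e ω i j)|}
      ≤ ENNReal.ofReal (2 * Real.exp (-(ε ^ 2 * n / 2))) := by
  have hcl : ∀ j, Measurable (fun p : 𝒴 × (Fin n → Fin n → ℝ) =>
      centeredLink (u p.1 i j) (p.2 i j)) := fun j =>
    measurable_centeredLink.comp (((hu i j).comp measurable_fst).prodMk
      ((measurable_pi_apply j).comp ((measurable_pi_apply i).comp measurable_snd)))
  refine measure_le_of_indepFun hY he hind
    (s := {p | ε * n ≤ |∑ j, c p.1 j * centeredLink (u p.1 i j) (p.2 i j)|}) ?_ fun y => ?_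
  · refine measurableSet_le measurable_const (Measurable.abs ?_)
    exact Finset.measurable_sum _ fun j _ => ((hc j).comp measurable_fst).mul (hcl j)
  · have hcl' : ∀ j, Measurable (fun t => c y j * centeredLink (u y i j) t) := fun j =>
      (measurable_centeredLink.comp (measurable_const.prodMk measurable_id)).const_mul _
    have hms : MeasurableSet {t : Fin n → ℝ |
        ε * n ≤ |∑ j, c y j * centeredLink (u y i j) (t j)|} :=
      measurableSet_le measurable_const (Measurable.abs
        (Finset.measurable_sum _ fun j _ => (hcl' j).comp (measurable_pi_apply j)))
    rw [hlaw]
    have := (measurePreserving_eval (fun _ : Fin n => Measure.pi (fun _ : Fin n => logistic))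
      i).measure_preimage hms.nullMeasurableSet
    refine (le_of_eq this).trans ?_
    rw [← ofReal_measureReal]
    refine ENNReal.ofReal_le_ofReal ?_
    refine measure_pi_abs_sum_ge_le (fun _ => logistic)
      (φ := fun j t => c y j * centeredLink (u y i j) t) hcl' ?_ ?_ hε
    · intro j t
      exact mul_mem_Icc_neg_one_one (hc1 y j) (centeredLink_mem_Icc _ _)
    · intro j
      rw [integral_const_mul, integral_centeredLink, mul_zero]

/-- Given the state, a tie means that the shock hits one point, and the logistic law has no atoms.
-/
lemma ae_add_shock_ne_zero (hY : Measurable Y) (he : Measurable e) (hind : IndepFun e Y P)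
    (hlaw : P.map e = Measure.pi (fun _ => Measure.pi (fun _ => logistic)))
    {u : 𝒴 → Fin n → Fin n → ℝ} (hu : ∀ i j, Measurable (fun y => u y i j)) (i j : Fin n) :
    ∀ᵐ ω ∂P, u (Y ω) i j + e ω i j ≠ 0 := by
  rw [ae_iff]
  simp only [ne_eq, not_not]
  refine le_antisymm ?_ zero_le
  refine measure_le_of_indepFun hY he hind (s := {p | u p.1 i j + p.2 i j = 0}) ?_ fun y => ?_
  · refine measurableSet_eq_fun (((hu i j).comp measurable_fst).add ?_) measurable_const
    exact (measurable_pi_apply j).comp ((measurable_pi_apply i).comp measurable_snd)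
  · rw [hlaw]
    have h1 := ((measurePreserving_eval (fun _ : Fin n => logistic) j).comp
      (measurePreserving_eval (fun _ : Fin n => Measure.pi (fun _ : Fin n => logistic))
      i)).measure_preimage (MeasurableSet.singleton (-(u y i j))).nullMeasurableSet
    rw [logistic_singleton] at h1
    refine le_of_eq (Eq.trans (congrArg _ ?_) h1)
    ext t
    simp only [Set.mem_ofPred_eq, Set.mem_preimage, Function.comp, Function.eval,
      Set.mem_singleton_iff]
    constructor <;> intro h <;> linarith

end Conditional

/-! ### The selected equilibrium -/

section Selection

variable {𝕏 V Ω : Type*} [MeasurableSpace V] [MeasurableSpace Ω] {d n : ℕ}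

/-- What the expected log-likelihood conditions on. -/
def Sample.state (S : Sample 𝕏 V Ω n) (ω : Ω) : (Fin n → 𝕏) × (Fin n → ℝ) × V :=
  (S.X ω, S.A ω, S.signal ω)

/-- The mean link probabilities of the selected equilibrium. -/
def selectedProb (F : (Fin n → 𝕏) → 𝕏 → Measure ℝ) (lam : (Fin n → 𝕏) → V → Belief n)
    (x : Fin n → 𝕏) (v : V) : Fin n → Fin n → ℝ :=
  meanLinkProb (fun i => F x (x i)) (lam x v)

/-- The indices that generate the observed network, as a function of the state. -/
def selectedIndex (w : 𝕏 → 𝕏 → Fin d → ℝ) (β₀ : Param d) (F : (Fin n → 𝕏) → 𝕏 → Measure ℝ)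
    (lam : (Fin n → 𝕏) → V → Belief n) (y : (Fin n → 𝕏) × (Fin n → ℝ) × V) (i j : Fin n) : ℝ :=
  index w β₀ y.1 (selectedProb F lam y.1 y.2.2) (y.2.1 i) i j

variable {P : Measure Ω} {S : Sample 𝕏 V Ω n} {F : (Fin n → 𝕏) → 𝕏 → Measure ℝ}
  {w : 𝕏 → 𝕏 → Fin d → ℝ} {β₀ : Param d} {lam : (Fin n → 𝕏) → V → Belief n}

lemma EquilibriumSelection.measurable_belief (h : EquilibriumSelection P S F w β₀ lam)
    (x : Fin n → 𝕏) (v : V) (i : Fin n) (g : Action i) :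
    Measurable (fun a => lam x v i a g) :=
  (h.measurable_lam x i g).comp (measurable_const.prodMk measurable_id)

lemma EquilibriumSelection.measurable_selectedProb [hF : ∀ x s, IsProbabilityMeasure (F x s)]
    (h : EquilibriumSelection P S F w β₀ lam) (x : Fin n → 𝕏) (i j : Fin n) :
    Measurable (fun v => selectedProb F lam x v i j) := by
  unfold selectedProb meanLinkProb linkProb
  have h1 : Measurable (fun p : V × ℝ =>
      ∑ g : Action i, if g.1 j = true then lam x p.1 i p.2 g else 0) := by
    refine Finset.measurable_sum _ fun g _ => ?_
    split_ifs
    exacts [h.measurable_lam x i g, measurable_const]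
  exact (h1.stronglyMeasurable.integral_prod_right' (ν := F x (x i))).measurable

variable [MeasurableSpace 𝕏]

lemma Primitives.measurable_state (h : Primitives P S F) : Measurable S.state :=
  h.measurable_X.prodMk (h.measurable_A.prodMk h.measurable_signal)

/-- There are finitely many attribute profiles, so measurability may be checked with `x` fixed; no
regularity in `x` is needed. -/
lemma EquilibriumSelection.measurable_selectedIndex [Finite 𝕏] [MeasurableSingletonClass 𝕏]
    [hF : ∀ x s, IsProbabilityMeasure (F x s)] (h : EquilibriumSelection P S F w β₀ lam)
    (i j : Fin n) : Measurable (fun y => selectedIndex w β₀ F lam y i j) := by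
  refine measurable_from_prod_countable_right fun x => ?_
  simp only [selectedIndex, index]
  have hq : ∀ k l, Measurable (fun p : (Fin n → ℝ) × V => selectedProb F lam x p.2 k l) :=
    fun k l => (h.measurable_selectedProb x k l).comp measurable_snd
  refine Measurable.add (Measurable.add (Measurable.add measurable_const ?_) ?_) ?_
  · exact (measurable_pi_apply i).comp measurable_fst
  · exact (hq j i).mul_const _
  · exact ((Finset.measurable_sum _ fun k _ => hq j k).const_mul _).mul_const _

/-- Almost surely, links are formed exactly if index plus shock is positive. -/
lemma EquilibriumSelection.ae_link_eq [Finite 𝕏] [MeasurableSingletonClass 𝕏]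
    [IsProbabilityMeasure P] [hF : ∀ x s, IsProbabilityMeasure (F x s)] (hprim : Primitives P S F)
    (h : EquilibriumSelection P S F w β₀ lam) :
    ∀ᵐ ω ∂P, ∀ i j, i ≠ j → link (S.G ω) i j
      = if 0 < selectedIndex w β₀ F lam (S.state ω) i j + S.shock ω i j then 1 else 0 := by
  have hties : ∀ᵐ ω ∂P, ∀ i j,
      selectedIndex w β₀ F lam (S.state ω) i j + S.shock ω i j ≠ 0 := by
    simp_rw [ae_all_iff]
    exact fun i j => ae_add_shock_ne_zero hprim.measurable_state hprim.measurable_shock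
      hprim.indep_shock hprim.law_shock h.measurable_selectedIndex i j
  filter_upwards [hties, h.best_reply, h.equilibrium] with ω h1 h2 h3 i j hij
  have h4 : ∀ g' : Action i,
      linearPayoff (fun j => selectedIndex w β₀ F lam (S.state ω) i j + S.shock ω i j) g'
      ≤ linearPayoff (fun j => selectedIndex w β₀ F lam (S.state ω) i j + S.shock ω i j)
        (S.G ω i) := by
    intro g'
    have := h2 i g'
    rwa [h3.expectedPayoff_eq (h.measurable_belief _ _), h3.expectedPayoff_eq
      (h.measurable_belief _ _)] at this
  exact link_eq_of_best_reply hij h4 (h1 i j)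

/-- The conditional expectation of a link indicator. -/
lemma EquilibriumSelection.ae_integral_link_eq [Finite 𝕏] [MeasurableSingletonClass 𝕏]
    [IsProbabilityMeasure P] [hF : ∀ x s, IsProbabilityMeasure (F x s)] (hprim : Primitives P S F)
    (h : EquilibriumSelection P S F w β₀ lam) :
    ∀ᵐ ω ∂P, ∀ i j, i ≠ j → ∫ g, link g i j ∂(condDistrib S.G S.state P (S.state ω))
      = Real.sigmoid (selectedIndex w β₀ F lam (S.state ω) i j) := by
  simp_rw [ae_all_iff]
  intro i j hij
  set u := fun y => selectedIndex w β₀ F lam y i j with hu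
  have hum : Measurable u := h.measurable_selectedIndex i j
  have hY := hprim.measurable_state
  have he := hprim.measurable_shock
  set s : Set (Network n) := {g | (g i).1 j = true} with hs
  have hsm : MeasurableSet s := MeasurableSet.of_discrete
  have hind := (indepFun_iff_map_prod_eq_prod_map_map hY.aemeasurable he.aemeasurable).1
    hprim.indep_shock.symm
  have : IsProbabilityMeasure (P.map S.state) := Measure.isProbabilityMeasure_map hY.aemeasurable
  -- The conditional probability is identified by its integrals over state events. Up to a null set
  -- the link event is positivity of index plus shock, and independence allows the shock to be
  -- integrated first.
  have hkey : (fun y => condDistrib S.G S.state P y s)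
      =ᵐ[P.map S.state] fun y => ENNReal.ofReal (Real.sigmoid (u y)) := by
    refine ae_eq_of_forall_setLIntegral_eq_of_sigmaFinite (Kernel.measurable_coe _ hsm)
      (continuous_sigmoid.measurable.comp hum).ennreal_ofReal fun t ht _ => ?_
    have e1 : ∫⁻ y in t, condDistrib S.G S.state P y s ∂(P.map S.state)
        = P (S.state ⁻¹' t ∩ S.G ⁻¹' s) := by
      rw [setLIntegral_map ht (Kernel.measurable_coe _ hsm) hY]
      exact setLIntegral_condDistrib_of_measurableSet hY hprim.measurable_G.aemeasurable hsm
        ⟨t, ht, rfl⟩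
    have e2 : P (S.state ⁻¹' t ∩ S.G ⁻¹' s)
        = P {ω | S.state ω ∈ t ∧ 0 < u (S.state ω) + S.shock ω i j} := by
      refine measure_congr ?_
      filter_upwards [h.ae_link_eq hprim] with ω hω
      have hl : (if (S.G ω i).1 j = true then (1 : ℝ) else 0)
        = if 0 < u (S.state ω) + S.shock ω i j then 1 else 0 := hω i j hij
      refine propext (and_congr Iff.rfl ?_)
      show (S.G ω i).1 j = true ↔ 0 < u (S.state ω) + S.shock ω i j
      constructor
      · intro ha
        by_contra hb
        rw [if_pos ha, if_neg hb] at hl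
        norm_num at hl
      · intro hb
        by_contra ha
        rw [if_neg ha, if_pos hb] at hl
        norm_num at hl
    have hset : MeasurableSet {p : ((Fin n → 𝕏) × (Fin n → ℝ) × V) × (Fin n → Fin n → ℝ) |
        p.1 ∈ t ∧ 0 < u p.1 + p.2 i j} := by
      have hlt : MeasurableSet {p : ((Fin n → 𝕏) × (Fin n → ℝ) × V) × (Fin n → Fin n → ℝ) |
          0 < u p.1 + p.2 i j} := by
        refine measurableSet_lt measurable_const ?_
        exact (hum.comp measurable_fst).add
          ((measurable_pi_apply j).comp ((measurable_pi_apply i).comp measurable_snd))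
      exact (measurable_fst ht).inter hlt
    have e3 : P {ω | S.state ω ∈ t ∧ 0 < u (S.state ω) + S.shock ω i j}
        = ∫⁻ y, (P.map S.shock) {e | y ∈ t ∧ 0 < u y + e i j} ∂(P.map S.state) := by
      have : IsProbabilityMeasure (P.map S.shock) :=
        Measure.isProbabilityMeasure_map he.aemeasurable
      have hm := Measure.map_apply (μ := P) (hY.prodMk he) hset
      rw [hind, Measure.prod_apply hset] at hm
      exact hm.symm
    rw [e1, e2, e3, ← lintegral_indicator ht]
    refine lintegral_congr fun y => ?_
    by_cases hy : y ∈ t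
    · simp only [hy, true_and, Set.indicator_of_mem]
      have hms : MeasurableSet {r : ℝ | 0 < u y + r} :=
        measurableSet_lt (by fun_prop) (by fun_prop)
      have h1 := ((measurePreserving_eval (fun _ : Fin n => logistic) j).comp
        (measurePreserving_eval (fun _ : Fin n => Measure.pi (fun _ : Fin n => logistic))
        i)).measure_preimage hms.nullMeasurableSet
      rw [hprim.law_shock, ← logistic_real_pos_add, ofReal_measureReal]
      exact h1
    · simp [hy]
  filter_upwards [ae_of_ae_map hY.aemeasurable hkey] with ω hω
  have h1 : (fun g : Network n => link g i j) = Set.indicator s (fun _ => 1) := by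
    ext g; simp [link, hs, Set.indicator_apply]
  rw [h1, integral_indicator_const _ hsm, smul_eq_mul, mul_one, measureReal_def, hω,
    ENNReal.toReal_ofReal (Real.sigmoid_nonneg _)]

/-- The expected log-likelihood is the logit log-likelihood at the true link probabilities. -/
lemma EquilibriumSelection.ae_expectedLogLik_eq [Finite 𝕏] [MeasurableSingletonClass 𝕏]
    [IsProbabilityMeasure P] [hF : ∀ x s, IsProbabilityMeasure (F x s)] (hprim : Primitives P S F)
    (h : EquilibriumSelection P S F w β₀ lam) :
    ∀ᵐ ω ∂P, ∀ β A, expectedLogLik P S F w lam ω β A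
      = logitLik (fun i j => choiceProb w β₀ (S.X ω) (selectedProb F lam (S.X ω) (S.signal ω))
          (S.A ω i) i j)
        (fun i j => index w β (S.X ω) (selectedProb F lam (S.X ω) (S.signal ω)) (A i) i j) := by
  filter_upwards [h.ae_integral_link_eq hprim] with ω hω β A
  unfold expectedLogLik
  simp only [logLik_eq_logitLik, logitLik]
  change ∫ g, _ ∂(condDistrib S.G S.state P (S.state ω)) = _
  -- The indices do not depend on the network, so the integral acts only on the links.
  rw [integral_const_mul, integral_finsetSum _ fun i _ => Integrable.of_finite]
  congr 1
  refine Finset.sum_congr rfl fun i _ => ?_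
  rw [integral_finsetSum _ fun i _ => Integrable.of_finite]
  refine Finset.sum_congr rfl fun j hj => ?_
  rw [integral_sub Integrable.of_finite Integrable.of_finite, integral_mul_const,
    hω i j (Finset.ne_of_mem_erase hj).symm, integral_const, probReal_univ, one_smul]
  rfl

end Selection

/-! ### Typical realizations have high probability -/

lemma measurable_sigmoid_add (c : ℝ) : Measurable (fun a => Real.sigmoid (c + a)) :=
  (continuous_sigmoid.comp (continuous_const.add continuous_id)).measurable

lemma integrable_sigmoid_add (μ : Measure ℝ) [IsProbabilityMeasure μ] (c : ℝ) :
    Integrable (fun a => Real.sigmoid (c + a)) μ :=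
  Integrable.of_mem_Icc 0 1 (measurable_sigmoid_add c).aemeasurable
    (ae_of_all _ fun _ => ⟨Real.sigmoid_nonneg _, Real.sigmoid_le_one _⟩)

lemma integral_sigmoid_add_mem_Icc (μ : Measure ℝ) [IsProbabilityMeasure μ] (c : ℝ) :
    ∫ a, Real.sigmoid (c + a) ∂μ ∈ Set.Icc (0 : ℝ) 1 := by
  refine ⟨integral_nonneg fun a => Real.sigmoid_nonneg _, ?_⟩
  refine (integral_mono (integrable_sigmoid_add μ c) (integrable_const 1)
    fun a => Real.sigmoid_le_one _).trans_eq ?_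
  simp

lemma abs_integral_sigmoid_add_sub_le (μ : Measure ℝ) [IsProbabilityMeasure μ] (c c' : ℝ) :
    |∫ a, Real.sigmoid (c + a) ∂μ - ∫ a, Real.sigmoid (c' + a) ∂μ| ≤ |c - c'| := by
  rw [← integral_sub (integrable_sigmoid_add μ c) (integrable_sigmoid_add μ c')]
  have := norm_integral_le_of_norm_le_const (μ := μ) (C := |c - c'|)
    (f := fun a => Real.sigmoid (c + a) - Real.sigmoid (c' + a)) (ae_of_all _ fun a => by
      refine (abs_sigmoid_sub_le _ _).trans_eq ?_
      congr 1; ring)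
  simpa using this

section TypicalEvent

variable {𝕏 : Type*} {n : ℕ} {F : (Fin n → 𝕏) → 𝕏 → Measure ℝ}

/-- The deviation of the types of the agents with attribute `s` from their conditional law, as
measured by the logistic function shifted by `c`. -/
def typeDeviation [DecidableEq 𝕏] (F : (Fin n → 𝕏) → 𝕏 → Measure ℝ) (x : Fin n → 𝕏)
    (A : Fin n → ℝ) (s : 𝕏) (c : ℝ) : ℝ :=
  ∑ k with x k = s, (Real.sigmoid (c + A k) - ∫ a, Real.sigmoid (c + a) ∂(F x s))

/-- Each of at most `n` summands is 2-Lipschitz in the shift, once through the sample term and once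
through its mean. A finite net of shifts therefore suffices. -/
lemma abs_typeDeviation_sub_le [DecidableEq 𝕏] [hF : ∀ x s, IsProbabilityMeasure (F x s)]
    (x : Fin n → 𝕏) (A : Fin n → ℝ) (s : 𝕏) (c c' : ℝ) :
    |typeDeviation F x A s c - typeDeviation F x A s c'| ≤ n * (2 * |c - c'|) := by
  unfold typeDeviation
  rw [← Finset.sum_sub_distrib]
  calc _ ≤ ∑ k with x k = s, 2 * |c - c'| := by
        refine (Finset.abs_sum_le_sum_abs _ _).trans (Finset.sum_le_sum fun k _ => ?_)
        have h1 := abs_sigmoid_sub_le (c + A k) (c' + A k)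
        rw [show c + A k - (c' + A k) = c - c' by ring] at h1
        have h2 := abs_integral_sigmoid_add_sub_le (F x s) c c'
        rw [sub_sub_sub_comm]
        refine (abs_sub _ _).trans ?_
        linarith
    _ ≤ n * (2 * |c - c'|) := by
        rw [Finset.sum_const, nsmul_eq_mul]
        refine mul_le_mul_of_nonneg_right ?_ (by positivity)
        have := Finset.card_le_univ (Finset.univ.filter (fun k => x k = s))
        rw [Fintype.card_fin] at this
        exact_mod_cast this

variable {V Ω : Type*} [Fintype 𝕏] [MeasurableSpace 𝕏] [MeasurableSingletonClass 𝕏]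
  [MeasurableSpace V] [MeasurableSpace Ω] {P : Measure Ω} [IsProbabilityMeasure P]
  {S : Sample 𝕏 V Ω n}

/-- A bound for all conditional probabilities given the attributes is a bound for the
probability. -/
lemma Primitives.measure_types_mem_le (h : Primitives P S F)
    {s : (Fin n → 𝕏) → Set (Fin n → ℝ)} (hs : ∀ x, MeasurableSet (s x)) {b : ENNReal}
    (hb : ∀ x, Measure.pi (fun i => F x (x i)) (s x) ≤ b) : P {ω | S.A ω ∈ s (S.X ω)} ≤ b := by
  have h1 : {ω | S.A ω ∈ s (S.X ω)} ⊆ ⋃ x, {ω | S.X ω = x ∧ S.A ω ∈ s x} := by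
    intro ω hω
    exact Set.mem_iUnion.2 ⟨S.X ω, rfl, hω⟩
  calc _ ≤ _ := measure_mono h1
    _ ≤ ∑ x, P {ω | S.X ω = x ∧ S.A ω ∈ s x} := measure_iUnion_fintype_le _ _
    _ = ∑ x, P {ω | S.X ω = x} * Measure.pi (fun i => F x (x i)) (s x) :=
        Finset.sum_congr rfl fun x _ => h.law_A x _ (hs x)
    _ ≤ ∑ x, P {ω | S.X ω = x} * b := Finset.sum_le_sum fun x _ => by gcongr; exact hb x
    _ = (∑ x, P (S.X ⁻¹' {x})) * b := by rw [Finset.sum_mul]; rfl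
    _ = b := by
        rw [sum_measure_preimage_singleton _ fun x _ =>
          h.measurable_X (MeasurableSet.singleton x)]
        simp

lemma Primitives.ae_types_mem [hF : ∀ x s, IsProbabilityMeasure (F x s)] (h : Primitives P S F)
    {𝔸 : Set ℝ} (h𝔸 : MeasurableSet 𝔸) (hF𝔸 : ∀ x s, F x s 𝔸ᶜ = 0) :
    ∀ᵐ ω ∂P, ∀ i, S.A ω i ∈ 𝔸 := by
  rw [ae_all_iff]
  intro i
  rw [ae_iff]
  refine le_antisymm ?_ zero_le
  refine h.measure_types_mem_le (s := fun _ => {a | a i ∈ 𝔸ᶜ})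
    (fun x => measurable_pi_apply i h𝔸.compl) fun x => ?_
  have := (measurePreserving_eval (fun i => F x (x i)) i).measure_preimage
    h𝔸.compl.nullMeasurableSet
  rw [hF𝔸] at this
  exact this.le

variable [DecidableEq 𝕏] {d : ℕ} {w : 𝕏 → 𝕏 → Fin d → ℝ} {β₀ : Param d}
  {lam : (Fin n → 𝕏) → V → Belief n}

/-- Given the attributes, types are independent and those of agents with attribute `s` have law `F x
s`. A zero weight for the other agents makes this a centered sum over all `n`. -/
lemma Primitives.measure_typeDeviation_le [hF : ∀ x s, IsProbabilityMeasure (F x s)]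
    (h : Primitives P S F) (s : 𝕏) (c : ℝ) {ε : ℝ} (hε : 0 ≤ ε) :
    P {ω | ε * n ≤ |typeDeviation F (S.X ω) (S.A ω) s c|}
      ≤ ENNReal.ofReal (2 * Real.exp (-(ε ^ 2 * n / 2))) := by
  set φ : (Fin n → 𝕏) → Fin n → ℝ → ℝ := fun x k a =>
    (if x k = s then 1 else 0) * (Real.sigmoid (c + a) - ∫ a, Real.sigmoid (c + a) ∂(F x s))
    with hφ
  have hdev : ∀ x A, typeDeviation F x A s c = ∑ k, φ x k (A k) := by
    intro x A
    rw [typeDeviation, Finset.sum_filter]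
    refine Finset.sum_congr rfl fun k _ => ?_
    simp only [hφ]; split_ifs <;> simp
  have hφm : ∀ x k, Measurable (φ x k) := fun x k =>
    ((measurable_sigmoid_add c).sub_const _).const_mul _
  simp only [hdev]
  refine h.measure_types_mem_le (s := fun x => {A | ε * n ≤ |∑ k, φ x k (A k)|}) ?_ fun x => ?_
  · intro x
    exact measurableSet_le measurable_const (Measurable.abs
      (Finset.measurable_sum _ fun k _ => (hφm x k).comp (measurable_pi_apply k)))
  · rw [← ofReal_measureReal]
    refine ENNReal.ofReal_le_ofReal
      (measure_pi_abs_sum_ge_le (fun i => F x (x i)) (hφm x) ?_ ?_ hε)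
    · intro k a
      have h1 := integral_sigmoid_add_mem_Icc (F x s) c
      have h2 := Real.sigmoid_nonneg (c + a)
      have h3 := Real.sigmoid_le_one (c + a)
      refine mul_mem_Icc_neg_one_one ?_ ?_
      · split_ifs <;> norm_num
      · constructor <;> linarith [h1.1, h1.2]
    · intro k
      simp only [hφ]
      by_cases hk : x k = s
      · rw [integral_const_mul, integral_sub (by rw [hk]; exact integrable_sigmoid_add _ _)
          (integrable_const _), hk]
        simp
      · simp [hk]

/-- Sufficient conditions for a realization to be typical. -/
lemma EquilibriumSelection.ae_isTypical [hF : ∀ x s, IsProbabilityMeasure (F x s)]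
    (hprim : Primitives P S F) (h : EquilibriumSelection P S F w β₀ lam) {W ε : ℝ} (hW0 : 0 ≤ W)
    (hW : ∀ s t b, |w s t ⬝ᵥ b| ≤ W * ‖b‖) (hn : 3 ≤ n) :
    ∀ᵐ ω ∂P,
      (∀ l s, |∑ k, (if k ≠ l ∧ S.X ω k = s then 1 else 0)
        * centeredLink (selectedIndex w β₀ F lam (S.state ω) k l) (S.shock ω k l)| ≤ ε * n) →
      (∀ i t, |∑ j, (if j ≠ i ∧ S.X ω j = t then 1 else 0)
        * centeredLink (selectedIndex w β₀ F lam (S.state ω) i j) (S.shock ω i j)| ≤ ε * n) →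
      (∀ s c, |c| ≤ (W + 2) * ‖β₀‖ → |typeDeviation F (S.X ω) (S.A ω) s c| ≤ ε * n) →
      IsTypical w β₀ (S.X ω) (S.A ω) (S.G ω) (selectedProb F lam (S.X ω) (S.signal ω)) ε := by
  filter_upwards [h.ae_link_eq hprim, h.equilibrium, h.symmetric] with ω hlink heq hsym hcol hrow
    htype
  have hmem : ∀ i j, selectedProb F lam (S.X ω) (S.signal ω) i j ∈ Set.Icc (0 : ℝ) 1 :=
    fun i j => heq.meanLinkProb_mem_Icc i j
  have hcent : ∀ i j, i ≠ j → link (S.G ω) i j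
      - choiceProb w β₀ (S.X ω) (selectedProb F lam (S.X ω) (S.signal ω)) (S.A ω i) i j
      = centeredLink (selectedIndex w β₀ F lam (S.state ω) i j) (S.shock ω i j) := by
    intro i j hij
    rw [hlink i j hij]; rfl
  refine ⟨hmem, exists_eq_of_attributes ?_, fun l s => ?_, fun i t => ?_, fun i j hij => ?_⟩
  · intro i j k l hij hkl hik hjl
    unfold selectedProb meanLinkProb
    simp only [hik]
    exact integral_congr_ae (ae_of_all _ fun a => hsym i j k l hij hkl hik hjl a)
  · refine le_of_eq_of_le (congrArg _ ?_) (hcol l s)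
    rw [← Finset.filter_ne', Finset.filter_filter, Finset.sum_filter]
    refine Finset.sum_congr rfl fun k _ => ?_
    split_ifs with hk
    · rw [hcent k l hk.1, one_mul]
    · rw [zero_mul]
  · refine le_of_eq_of_le (congrArg _ ?_) (hrow i t)
    rw [← Finset.filter_ne', Finset.filter_filter, Finset.sum_filter]
    refine Finset.sum_congr rfl fun k _ => ?_
    split_ifs with hk
    · rw [hcent i k hk.1.symm, one_mul]
    · rw [zero_mul]
  · have hc := abs_index_le hW0 hW hmem hn hij (S.X ω) β₀ 0
    rw [abs_zero, add_zero] at hc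
    refine le_of_eq_of_le (congrArg _ ?_) (htype (S.X ω i) _ hc)
    -- The equilibrium condition: `q i j` is the mean of the logistic function shifted by the index
    -- at type `0`. This shift depends on the signal, hence the uniformity in `c`.
    have hq : selectedProb F lam (S.X ω) (S.signal ω) i j = ∫ a, Real.sigmoid
        (index w β₀ (S.X ω) (selectedProb F lam (S.X ω) (S.signal ω)) 0 i j + a)
          ∂(F (S.X ω) (S.X ω i)) := by
      conv_lhs => unfold selectedProb meanLinkProb
      refine integral_congr_ae (ae_of_all _ fun a => ?_)
      simp only
      rw [heq.linkProb_eq (h.measurable_belief _ _) hij, index_eq_add]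
      rfl
    unfold typeDeviation
    refine Finset.sum_congr rfl fun k _ => ?_
    rw [← hq, ← index_eq_add]

/-- A non-asymptotic bound for the probability of atypical realizations. -/
lemma EquilibriumSelection.measure_not_isTypical_le [hF : ∀ x s, IsProbabilityMeasure (F x s)]
    (hprim : Primitives P S F) (h : EquilibriumSelection P S F w β₀ lam) {W ε : ℝ} (hW0 : 0 ≤ W)
    (hW : ∀ s t b, |w s t ⬝ᵥ b| ≤ W * ‖b‖) (hn : 3 ≤ n) (hε : 0 < ε) {T : Finset ℝ}
    (hT : ∀ c, |c| ≤ (W + 2) * ‖β₀‖ → ∃ t ∈ T, |c - t| ≤ ε / 4) :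
    P {ω | ¬ IsTypical w β₀ (S.X ω) (S.A ω) (S.G ω) (selectedProb F lam (S.X ω) (S.signal ω)) ε}
      ≤ ((2 * n + T.card) * Fintype.card 𝕏 : ℕ)
        * ENNReal.ofReal (2 * Real.exp (-((ε / 2) ^ 2 * n / 2))) := by
  set b := ENNReal.ofReal (2 * Real.exp (-((ε / 2) ^ 2 * n / 2))) with hb
  -- Half of `ε` goes to the deviation at a net point; net distance `ε / 4` times Lipschitz constant
  -- `2 n` uses the other half.
  have hε2 : 0 ≤ ε / 2 := by linarith
  set C : Fin n × 𝕏 → Set Ω := fun p => {ω | ε / 2 * n ≤ |∑ k,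
    (if k ≠ p.1 ∧ S.X ω k = p.2 then 1 else 0)
      * centeredLink (selectedIndex w β₀ F lam (S.state ω) k p.1) (S.shock ω k p.1)|} with hC
  set R : Fin n × 𝕏 → Set Ω := fun p => {ω | ε / 2 * n ≤ |∑ j,
    (if j ≠ p.1 ∧ S.X ω j = p.2 then 1 else 0)
      * centeredLink (selectedIndex w β₀ F lam (S.state ω) p.1 j) (S.shock ω p.1 j)|} with hR
  set D : T × 𝕏 → Set Ω := fun p => {ω | ε / 2 * n ≤ |typeDeviation F (S.X ω) (S.A ω) p.2 p.1|}
    with hD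
  have hind1 : ∀ (y : (Fin n → 𝕏) × (Fin n → ℝ) × V) (p : Fin n × 𝕏) (k : Fin n),
      (if k ≠ p.1 ∧ y.1 k = p.2 then (1 : ℝ) else 0) ∈ Set.Icc (0 : ℝ) 1 := by
    intro y p k
    split_ifs <;> norm_num
  have hindm : ∀ (p : Fin n × 𝕏) (k : Fin n),
      Measurable (fun y : (Fin n → 𝕏) × (Fin n → ℝ) × V =>
        if k ≠ p.1 ∧ y.1 k = p.2 then (1 : ℝ) else 0) := fun p k =>
    (Measurable.of_discrete (f := fun x : Fin n → 𝕏 =>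
      if k ≠ p.1 ∧ x k = p.2 then (1 : ℝ) else 0)).comp measurable_fst
  have hCb : ∀ p, P (C p) ≤ b := fun p =>
    measure_column_le hprim.measurable_state hprim.measurable_shock hprim.indep_shock
      hprim.law_shock h.measurable_selectedIndex (hindm p) (fun y k => hind1 y p k) p.1 hε2
  have hRb : ∀ p, P (R p) ≤ b := fun p =>
    measure_row_le hprim.measurable_state hprim.measurable_shock hprim.indep_shock
      hprim.law_shock h.measurable_selectedIndex (hindm p) (fun y k => hind1 y p k) p.1 hε2
  have hDb : ∀ p, P (D p) ≤ b := fun p => hprim.measure_typeDeviation_le p.2 p.1 hε2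
  have hεn : ε / 2 * n ≤ ε * n := mul_le_mul_of_nonneg_right (by linarith) (by positivity)
  have hsub : {ω | ¬ IsTypical w β₀ (S.X ω) (S.A ω) (S.G ω)
      (selectedProb F lam (S.X ω) (S.signal ω)) ε}
      ≤ᵐ[P] (((⋃ p, C p) ∪ (⋃ p, R p)) ∪ ⋃ p, D p : Set Ω) := by
    filter_upwards [h.ae_isTypical hprim hW0 hW hn (ε := ε)] with ω hω hnot
    by_contra hcon
    have hcon' : ω ∉ ((⋃ p, C p) ∪ (⋃ p, R p)) ∪ ⋃ p, D p := hcon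
    simp only [Set.mem_union, Set.mem_iUnion, not_or, not_exists] at hcon'
    obtain ⟨⟨h1, h2⟩, h3⟩ := hcon'
    refine hnot (hω (fun l s => ?_) (fun i t => ?_) fun s c hc => ?_)
    · exact (not_le.1 (h1 (l, s))).le.trans hεn
    · exact (not_le.1 (h2 (i, t))).le.trans hεn
    · obtain ⟨t, ht, hct⟩ := hT c hc
      have h4 : |typeDeviation F (S.X ω) (S.A ω) s t| ≤ ε / 2 * n :=
        (not_le.1 (h3 (⟨t, ht⟩, s))).le
      have h5 := abs_typeDeviation_sub_le (F := F) (S.X ω) (S.A ω) s c t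
      have h6 : (n : ℝ) * (2 * |c - t|) ≤ ε / 2 * n := by
        have : (0 : ℝ) ≤ n := by positivity
        nlinarith
      calc |typeDeviation F (S.X ω) (S.A ω) s c|
          = |(typeDeviation F (S.X ω) (S.A ω) s c - typeDeviation F (S.X ω) (S.A ω) s t)
            + typeDeviation F (S.X ω) (S.A ω) s t| := by ring_nf
        _ ≤ ε / 2 * n + ε / 2 * n := (abs_add_le _ _).trans (add_le_add (h5.trans h6) h4)
        _ = ε * n := by ring
  have hunion : ∀ {ι : Type _} [Fintype ι] (E : ι → Set Ω), (∀ p, P (E p) ≤ b) →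
      P (⋃ p, E p) ≤ Fintype.card ι * b := by
    intro ι _ E hE
    refine (measure_iUnion_fintype_le _ _).trans ?_
    rw [← nsmul_eq_mul]
    exact Finset.sum_le_card_nsmul _ _ _ fun p _ => hE p
  calc _ ≤ _ := measure_mono_ae hsub
    _ ≤ P (⋃ p, C p) + P (⋃ p, R p) + P (⋃ p, D p) :=
        (measure_union_le _ _).trans (add_le_add (measure_union_le _ _) le_rfl)
    _ ≤ Fintype.card (Fin n × 𝕏) * b + Fintype.card (Fin n × 𝕏) * b
        + Fintype.card (T × 𝕏) * b :=
        add_le_add (add_le_add (hunion C hCb) (hunion R hRb)) (hunion D hDb)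
    _ = _ := by
        rw [← add_mul, ← add_mul]
        congr 1
        simp only [Fintype.card_prod, Fintype.card_fin, Fintype.card_coe]
        push_cast; ring

end TypicalEvent

/-! ### Consistency -/

lemma exists_finset_net (C : ℝ) {δ : ℝ} (hδ : 0 < δ) :
    ∃ T : Finset ℝ, ∀ c, |c| ≤ C → ∃ t ∈ T, |c - t| ≤ δ := by
  obtain ⟨t, -, htf, hcov⟩ := finite_cover_balls_of_compact (isCompact_Icc (a := -C) (b := C)) hδ
  refine ⟨htf.toFinset, fun c hc => ?_⟩
  obtain ⟨s, hs, hcs⟩ := Set.mem_iUnion₂.1 (hcov (abs_le.1 hc))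
  exact ⟨s, htf.mem_toFinset.2 hs, (Metric.mem_ball.1 hcs).le⟩

/-- The union bound ranges over a number of events linear in `n`, and `n r ^ n → 0` for `r < 1`. -/
lemma tendsto_linear_mul_exp_neg (a b : ℕ) {c : ℝ} (hc : 0 < c) :
    Tendsto (fun n : ℕ => (((2 * n + a) * b : ℕ) : ENNReal)
      * ENNReal.ofReal (2 * Real.exp (-(c * n / 2)))) atTop (𝓝 0) := by
  have hr0 : 0 ≤ Real.exp (-(c / 2)) := (Real.exp_pos _).le
  have hr1 : Real.exp (-(c / 2)) < 1 := Real.exp_lt_one_iff.2 (by linarith)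
  have h1 := tendsto_self_mul_const_pow_of_lt_one hr0 hr1
  have h2 := tendsto_pow_atTop_nhds_zero_of_lt_one hr0 hr1
  have h3 := (h1.const_mul (4 * (b : ℝ))).add (h2.const_mul (2 * (a : ℝ) * b))
  rw [mul_zero, mul_zero, add_zero] at h3
  have h4 := ENNReal.tendsto_ofReal h3
  rw [ENNReal.ofReal_zero] at h4
  refine h4.congr fun n => ?_
  rw [← ENNReal.ofReal_natCast, ← ENNReal.ofReal_mul (by positivity), ← Real.exp_nat_mul]
  congr 1
  push_cast
  rw [show (n : ℝ) * -(c / 2) = -(c * n / 2) by ring]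
  ring

section Consistency

variable {𝕏 : Type*} [Fintype 𝕏] [DecidableEq 𝕏] {d : ℕ}

section FixedSize

variable {V Ω : Type*} [MeasurableSpace 𝕏] [MeasurableSpace V] [MeasurableSpace Ω] {n : ℕ}
  {P : Measure Ω} [IsProbabilityMeasure P] {S : Sample 𝕏 V Ω n}
  {F : (Fin n → 𝕏) → 𝕏 → Measure ℝ} {w : 𝕏 → 𝕏 → Fin d → ℝ} {β₀ : Param d}
  {lam : (Fin n → 𝕏) → V → Belief n}

/-- In a typical realization with a separated maximum, the estimate of the common parameter is
close to the true one. -/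
lemma IsTypical.norm_sub_lt {ω : Ω} {W R RA ε r η : ℝ}
    (h : IsTypical w β₀ (S.X ω) (S.A ω) (S.G ω) (selectedProb F lam (S.X ω) (S.signal ω)) ε)
    (hlik : ∀ β A, expectedLogLik P S F w lam ω β A
      = logitLik (fun i j => choiceProb w β₀ (S.X ω) (selectedProb F lam (S.X ω) (S.signal ω))
          (S.A ω i) i j)
        (fun i j => index w β (S.X ω) (selectedProb F lam (S.X ω) (S.signal ω)) (A i) i j))
    (hW0 : 0 ≤ W) (hW : ∀ s t b, |w s t ⬝ᵥ b| ≤ W * ‖b‖) (hn : 3 ≤ n) (hεn : 1 ≤ ε * n)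
    {B : Set (Param d)} {𝔸 : Set ℝ} (hB : ∀ β ∈ B, ‖β‖ ≤ R) (h𝔸 : ∀ a ∈ 𝔸, |a| ≤ RA)
    (hβ₀ : β₀ ∈ B) (hA₀ : ∀ i, S.A ω i ∈ 𝔸) (hsep : SeparatedMaximum P S F w lam B 𝔸 β₀ r η ω)
    (hη : 2 * (Fintype.card 𝕏 * (40 * R + 2 * ((W + 2) * R + RA)) * ε) < η)
    {β : Param d} {A : Fin n → ℝ} (hmle : IsTwoStepMLE w B 𝔸 (S.X ω) (S.G ω) β A) :
    ‖β - β₀‖ < r := by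
  obtain ⟨hβ, hA, hmax⟩ := hmle
  by_contra hcon
  have hdist : r ≤ ‖β - β₀‖ + (n : ℝ)⁻¹ * ∑ i, |A i - S.A ω i| := by
    have : 0 ≤ (n : ℝ)⁻¹ * ∑ i, |A i - S.A ω i| := by positivity
    linarith
  have h1 := hsep β hβ A hA hdist
  rw [hlik, hlik] at h1
  have h2 := abs_le.1 (h.abs_logLik_sub_le hW0 hW hn hεn (hB β hβ) (fun i => h𝔸 _ (hA i)))
  have h3 := abs_le.1 (h.abs_logLik_sub_le hW0 hW hn hεn (hB β₀ hβ₀) (fun i => h𝔸 _ (hA₀ i)))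
  -- The estimate beats the truth in the feasible likelihood, so its expected likelihood falls short
  -- by at most twice the uniform error, which is less than `η`.
  have h4 := hmax β₀ hβ₀ (S.A ω) hA₀
  linarith [h2.1, h2.2, h3.1, h3.2]

end FixedSize

variable [MeasurableSpace 𝕏] [MeasurableSingletonClass 𝕏]
  {Ω : ℕ → Type*} [∀ n, MeasurableSpace (Ω n)]
  {P : (n : ℕ) → Measure (Ω n)} [∀ n, IsProbabilityMeasure (P n)]
  {V : ℕ → Type*} [∀ n, MeasurableSpace (V n)] {w : 𝕏 → 𝕏 → Fin d → ℝ}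
  {S : (n : ℕ) → Sample 𝕏 (V n) (Ω n) n} {F : (n : ℕ) → (Fin n → 𝕏) → 𝕏 → Measure ℝ}
  {β₀ : Param d} {lam : (n : ℕ) → (Fin n → 𝕏) → V n → Belief n}

/-- Realizations are typical with probability tending to one. -/
lemma tendsto_measure_not_isTypical [hF : ∀ n x s, IsProbabilityMeasure (F n x s)]
    (hprim : ∀ n, Primitives (P n) (S n) (F n))
    (hsel : ∀ᶠ n in atTop, EquilibriumSelection (P n) (S n) (F n) w β₀ (lam n))
    {ε : ℝ} (hε : 0 < ε) :
    Tendsto (fun n => P n {ω | ¬ IsTypical w β₀ ((S n).X ω) ((S n).A ω) ((S n).G ω)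
      (selectedProb (F n) (lam n) ((S n).X ω) ((S n).signal ω)) ε}) atTop (𝓝 0) := by
  obtain ⟨W, hW0, hW⟩ := exists_dotProduct_bound w
  obtain ⟨T, hT⟩ := exists_finset_net ((W + 2) * ‖β₀‖) (show 0 < ε / 4 by linarith)
  refine tendsto_of_tendsto_of_tendsto_of_le_of_le' tendsto_const_nhds
    (tendsto_linear_mul_exp_neg T.card (Fintype.card 𝕏) (show 0 < (ε / 2) ^ 2 by positivity))
    (Eventually.of_forall fun _ => zero_le) ?_
  filter_upwards [hsel, eventually_ge_atTop 3] with n hn hn3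
  exact hn.measure_not_isTypical_le (hprim n) hW0 hW hn3 hε hT

lemma eventually_one_le_mul {ε : ℝ} (hε : 0 < ε) : ∀ᶠ n : ℕ in atTop, 1 ≤ ε * n :=
  (tendsto_natCast_atTop_atTop.const_mul_atTop hε).eventually_ge_atTop 1

end Consistency

end

end NetFormation

/-! ### The consistency theorem -/

open NetFormation in
theorem theorem1 {𝕏 : Type*} [Fintype 𝕏] [DecidableEq 𝕏] [MeasurableSpace 𝕏]
    [MeasurableSingletonClass 𝕏] {d : ℕ}
    {Ω : ℕ → Type*} [∀ n, MeasurableSpace (Ω n)]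
    (P : (n : ℕ) → Measure (Ω n)) [∀ n, IsProbabilityMeasure (P n)]
    {V : ℕ → Type*} [∀ n, MeasurableSpace (V n)]
    (w : 𝕏 → 𝕏 → Fin d → ℝ)
    (S : (n : ℕ) → Sample 𝕏 (V n) (Ω n) n)
    (F : (n : ℕ) → (Fin n → 𝕏) → 𝕏 → Measure ℝ)
    (hF : ∀ n x s, IsProbabilityMeasure (F n x s))
    (hprim : ∀ n, Primitives (P n) (S n) (F n))
    (𝔸 : Set ℝ) (h𝔸 : IsCompact 𝔸) (hF𝔸 : ∀ n x s, F n x s 𝔸ᶜ = 0)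
    (B : Set (Param d)) (hB : IsCompact B) (β₀ : Param d) (hβ₀ : β₀ ∈ interior B)
    (lam : (n : ℕ) → (Fin n → 𝕏) → V n → Belief n)
    (hsel : ∀ᶠ n in atTop, EquilibriumSelection (P n) (S n) (F n) w β₀ (lam n))
    (hident : ∀ r > 0, ∀ δ > 0, ∃ η > 0, ∀ᶠ n in atTop,
      P n {ω | ¬ SeparatedMaximum (P n) (S n) (F n) w (lam n) B 𝔸 β₀ r η ω} ≤ ENNReal.ofReal δ)
    (βhat : (n : ℕ) → Ω n → Param d) (Ahat : (n : ℕ) → Ω n → Fin n → ℝ)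
    (hmle : ∀ᶠ n in atTop, ∀ᵐ ω ∂(P n),
      IsTwoStepMLE w B 𝔸 ((S n).X ω) ((S n).G ω) (βhat n ω) (Ahat n ω)) :
    (∀ r > 0, Tendsto (fun n => P n {ω | r ≤ ‖βhat n ω - β₀‖}) atTop (𝓝 0)) ∧
    (∀ r > 0, Tendsto (fun n => P n {ω | ∃ i, r ≤ |Ahat n ω i - (S n).A ω i|}) atTop (𝓝 0)) := by
  have hβB : β₀ ∈ B := interior_subset hβ₀
  obtain ⟨R, hR⟩ := hB.isBounded.exists_norm_le
  obtain ⟨RA, hRA⟩ := h𝔸.isBounded.exists_norm_le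
  obtain ⟨W, hW0, hW⟩ := exists_dotProduct_bound w
  have hR0 : 0 ≤ R := (norm_nonneg _).trans (hR β₀ hβB)
  have hcommon : ∀ r > 0, Tendsto (fun n => P n {ω | r ≤ ‖βhat n ω - β₀‖}) atTop (𝓝 0) := by
    intro r hr
    rw [ENNReal.tendsto_nhds_zero]
    intro δ hδ
    -- `δ` may be infinite, whereas the identification hypothesis takes a real tolerance.
    obtain ⟨δ', hδ'0, hδ'⟩ := ENNReal.lt_iff_exists_nnreal_btwn.1 (ENNReal.half_pos hδ.ne')
    obtain ⟨η, hη, hsep⟩ := hident r hr δ' (by exact_mod_cast hδ'0)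
    rw [ENNReal.ofReal_coe_nnreal] at hsep
    -- The absolute value spares a discussion of the sign of `RA`; `ε` is chosen to make twice the
    -- uniform error at most `η / 2`.
    set C : ℝ := |Fintype.card 𝕏 * (40 * R + 2 * ((W + 2) * R + RA))| with hC
    have hC0 : 0 ≤ C := abs_nonneg _
    set ε : ℝ := η / (4 * (C + 1)) with hε
    have hε0 : 0 < ε := by positivity
    have hηε : 2 * (Fintype.card 𝕏 * (40 * R + 2 * ((W + 2) * R + RA)) * ε) < η := by
      have h1 : Fintype.card 𝕏 * (40 * R + 2 * ((W + 2) * R + RA)) * ε ≤ C * ε :=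
        mul_le_mul_of_nonneg_right (le_abs_self _) hε0.le
      have h2 : (C + 1) * ε = η / 4 := by rw [hε]; field_simp
      nlinarith
    have htyp := (ENNReal.tendsto_nhds_zero.1
      (tendsto_measure_not_isTypical hprim hsel hε0)) (δ / 2) (ENNReal.half_pos hδ.ne')
    filter_upwards [hsep, htyp, hsel, hmle, eventually_ge_atTop 3, eventually_one_le_mul hε0]
      with n hsepn htypn hseln hmlen hn hεn
    have hsub : {ω | r ≤ ‖βhat n ω - β₀‖} ≤ᵐ[P n]
        ({ω | ¬ SeparatedMaximum (P n) (S n) (F n) w (lam n) B 𝔸 β₀ r η ω}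
          ∪ {ω | ¬ IsTypical w β₀ ((S n).X ω) ((S n).A ω) ((S n).G ω)
            (selectedProb (F n) (lam n) ((S n).X ω) ((S n).signal ω)) ε} : Set (Ω n)) := by
      filter_upwards [hmlen, hseln.ae_expectedLogLik_eq (hprim n),
        (hprim n).ae_types_mem h𝔸.measurableSet (hF𝔸 n)] with ω h1 h2 h3 h4
      by_contra hcon
      obtain ⟨h5, h6⟩ := not_or.1 hcon
      exact absurd h4 (not_le.2 ((not_not.1 h6).norm_sub_lt h2 hW0 hW hn hεn hR hRA hβB h3
        (not_not.1 h5) hηε h1))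
    calc _ ≤ _ := measure_mono_ae hsub
      _ ≤ _ := measure_union_le _ _
      _ ≤ δ / 2 + δ / 2 := add_le_add (hsepn.trans hδ'.le) htypn
      _ = δ := ENNReal.add_halves δ
  refine ⟨hcommon, fun r hr => ?_⟩
  set c := curvature ((W + 2) * R + RA) with hc
  have hc0 : 0 < c := curvature_pos _
  set D : ℝ := Fintype.card 𝕏 * (2 + 20 * R) with hD
  have hD0 : 0 ≤ D := by positivity
  set ε : ℝ := c * r / (8 * (D + 1)) with hε
  have hε0 : 0 < ε := by positivity
  -- Both error terms in the bound for a type become at most `c r / 8`, and their sum stays below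
  -- the `c r / 2` that an error of size `r` would require.
  set ρ : ℝ := c * r / (8 * (W + 2)) with hρ
  have hρ0 : 0 < ρ := by positivity
  have hDε : D * ε ≤ c * r / 8 := by
    have : (D + 1) * ε = c * r / 8 := by rw [hε]; field_simp
    nlinarith
  have hWρ : (W + 2) * ρ = c * r / 8 := by rw [hρ]; field_simp
  have hlim := (hcommon ρ hρ0).add (tendsto_measure_not_isTypical hprim hsel hε0)
  rw [add_zero] at hlim
  refine tendsto_of_tendsto_of_tendsto_of_le_of_le' tendsto_const_nhds hlim
    (Eventually.of_forall fun _ => zero_le) ?_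
  filter_upwards [hsel, hmle, eventually_ge_atTop 3, eventually_one_le_mul hε0]
    with n hseln hmlen hn hεn
  have hsub : {ω | ∃ i, r ≤ |Ahat n ω i - (S n).A ω i|} ≤ᵐ[P n]
      ({ω | ρ ≤ ‖βhat n ω - β₀‖}
        ∪ {ω | ¬ IsTypical w β₀ ((S n).X ω) ((S n).A ω) ((S n).G ω)
          (selectedProb (F n) (lam n) ((S n).X ω) ((S n).signal ω)) ε} : Set (Ω n)) := by
    filter_upwards [hmlen, (hprim n).ae_types_mem h𝔸.measurableSet (hF𝔸 n)] with ω h1 h2 h3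
    by_contra hcon
    obtain ⟨h5, h6⟩ := not_or.1 hcon
    obtain ⟨i, hi⟩ := (h3 : ∃ i, r ≤ |Ahat n ω i - (S n).A ω i|)
    have h7 := (not_not.1 h6).abs_type_sub_le hW0 hW hn hεn hR hRA h2 h1 i
    have h8 : (W + 2) * ‖βhat n ω - β₀‖ ≤ (W + 2) * ρ :=
      mul_le_mul_of_nonneg_left (not_le.1 h5).le (by linarith)
    have h9 : c / 2 * r ≤ c / 2 * |Ahat n ω i - (S n).A ω i| :=
      mul_le_mul_of_nonneg_left hi (by linarith)
    have h10 : 0 < c * r := mul_pos hc0 hr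
    linarith
  exact (measure_mono_ae hsub).trans (measure_union_le _ _)
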